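/- **Definitions.** A *$\dagger$-symmetric monoidal category* ($\dagger$-SMC) is a symmetric monoidal category with an involutive, identity-on-objects, contravariant endofunctor $\dagger$ that preserves $\otimes$ of morphisms and for which the associativity, unit and symmetry isomorphisms are unitary ($f$ is *unitary* if it is invertible with $f^{-1}=f^\dagger$). A *$\dagger$-Frobenius structure* on an object $A$ is a cocommutative comonoid $(A,\ \delta_A:A\to A\otimes A,\ \gamma_A:A\to I)$ with $$\delta_A^\dagger\circ\delta_A=1_A,\qquad \delta_A\circ\delta_A^\dagger=(\delta_A^\dagger\otimes 1_A)\circ(1_A\otimes\delta_A)$$ (associativity isomorphisms suppressed). A *$\dagger$-compact category with bases* is a $\dagger$-SMC in which every object $A$ has a chosen dual object $A^*$, with $A^{**}=A$, and a *$\dagger$-dual Frobenius structure*, i.e. a $\dagger$-Frobenius structure $(\delta_A,\gamma_A)$ together with a unitary $d_A:A\to A^*$ (the dualiser), such that $d_{A^*}=d_A^\dagger$, $\ \delta_{A^*}\circ d_A=(d_A\otimes d_A)\circ\delta_A$ and $\gamma_{A^*}\circ d_A=\gamma_A$. Let $A$ be an object of a $\dagger$-compact category with bases. A *diagram* is a formal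 expression built by composition, tensor and dagger from identities, the associativity, unit and symmetry isomorphisms, and $\delta_A,\gamma_A,d_A,\delta_{A^*},\gamma_{A^*},d_{A^*}$. Its source and its target are formal tensor expressions in $A$ (an upward wire) and $A^*$ (a downward wire); their lists of factors, read from left to right, are the *orientations* of its inputs and of its outputs. A diagram is *connected* if its underlying graph (one node for each occurrence of $\delta$, $\gamma$ or $d$ and for each wire of an identity or structural isomorphism, with an edge wherever an output of one piece is plugged into an input of the next) is nonempty and connected. For a list $w=(b_1,\dots,b_n)$ of orientations let $m_w: b_1\otimes(b_2\otimes\cdots)\to A$ be the merging of the legs: $m_{()}=\gamma_A^\dagger$ and $m_{(b_1,\dots,b_n)}=\delta_A^\dagger\circ(\ell_{b_1}\otimes m_{(b_2,\dots,b_n)})$, where $\ell_A=1_A$ and $\ell_{A^*}=d_{A^*}:A^*\to A$. The *spider with directed legs* with input orientations $w$ and output orientations $w'$ is $S_{w,w'}=m_{w'}^\dagger\circ m_w$. **Theorem (oriented spider).** Let $A$ be an object of a $\dagger$-compact category with bases, and let $\Xi:X\to Y$ be a connected diagram whose inputs have orientations $w$ and whose outputs have orientations $w'$. Then, up to the canonical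 rebracketings of $X$ and $Y$ into right-bracketed tensor products, $$\Xi = S_{w,w'} .$$ Hence the morphism denoted by a connected diagram depends only on the number of inputs, the number of outputs, and their orientations: any two connected diagrams with the same lists of input and of output orientations denote the same morphism, up to the canonical rebracketings of source and target. -/

import Mathlib

open CategoryTheory MonoidalCategory

universe v u

namespace OrientedSpider

/-! ### Dagger symmetric monoidal categories -/

/-- A `†`-symmetric monoidal category: a symmetric monoidal category with an involutive,
identity-on-objects, contravariant endofunctor `†` preserving the tensor product of morphisms and
for which the structural isomorphisms are unitary. -/
class DaggerSMC (C : Type u) [Category.{v} C] [MonoidalCategory C] [SymmetricCategory C] where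
  dagger : ∀ {A B : C}, (A ⟶ B) → (B ⟶ A)
  dagger_id : ∀ A : C, dagger (𝟙 A) = 𝟙 A
  dagger_comp : ∀ {A B D : C} (f : A ⟶ B) (g : B ⟶ D), dagger (f ≫ g) = dagger g ≫ dagger f
  dagger_dagger : ∀ {A B : C} (f : A ⟶ B), dagger (dagger f) = f
  dagger_tensor : ∀ {A B D E : C} (f : A ⟶ B) (g : D ⟶ E),
    dagger (f ⊗ₘ g) = dagger f ⊗ₘ dagger g
  dagger_associator : ∀ A B D : C, dagger (α_ A B D).hom = (α_ A B D).inv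
  dagger_leftUnitor : ∀ A : C, dagger (λ_ A).hom = (λ_ A).inv
  dagger_rightUnitor : ∀ A : C, dagger (ρ_ A).hom = (ρ_ A).inv
  dagger_braiding : ∀ A B : C, dagger (β_ A B).hom = (β_ A B).inv

section Structures

variable {C : Type u} [Category.{v} C] [MonoidalCategory C] [SymmetricCategory C] [DaggerSMC C]

/-- A morphism is unitary if it is an isomorphism whose inverse is its dagger. -/
def IsUnitary {A B : C} (f : A ⟶ B) : Prop :=
  f ≫ DaggerSMC.dagger f = 𝟙 A ∧ DaggerSMC.dagger f ≫ f = 𝟙 B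

/-- A `†`-Frobenius structure on `A`: an internal cocommutative comonoid
`(δ = comul, γ = counit)` with `δ† ∘ δ = 1` and `δ ∘ δ† = (δ† ⊗ 1) ∘ (1 ⊗ δ)`. -/
structure DaggerFrobenius (A : C) extends ComonObj A where
  comul_comm : comul ≫ (β_ A A).hom = comul
  special : comul ≫ DaggerSMC.dagger comul = 𝟙 A
  frobenius : DaggerSMC.dagger comul ≫ comul =
    (𝟙 A ⊗ₘ comul) ≫ (α_ A A A).inv ≫ (DaggerSMC.dagger comul ⊗ₘ 𝟙 A)

/-- `f` is a permutation between `†`-Frobenius structures: a unitary total map. -/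
structure IsPermutation {A B : C} (F : DaggerFrobenius A) (G : DaggerFrobenius B) (f : A ⟶ B) :
    Prop where
  partialMap : f ≫ G.comul = F.comul ≫ (f ⊗ₘ f)
  totalMap : f ≫ G.counit = F.counit
  unitary : IsUnitary f

/-- A `†`-dual Frobenius structure on `A` with chosen dual object `A'`: a `†`-Frobenius structure
on `A` and a unitary `A ⟶ A'`, the dualiser. -/
structure DaggerDualFrobenius (A A' : C) extends DaggerFrobenius A where
  dualiser : A ⟶ A'
  dualiser_unitary : IsUnitary dualiser

end Structures

/-- A `†`-compact category with bases: every object `A` carries a `†`-dual Frobenius structure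
with dualiser `d_A : A ⟶ A*`, such that `d_A` is a permutation and `d_{A*} = d_A†`. The latter
equation presupposes `A** = A`; the `eqToHom` is the corresponding identity. -/
class DaggerCompactWithBases (C : Type u) [Category.{v} C] [MonoidalCategory C]
    [SymmetricCategory C] [DaggerSMC C] where
  dual : C → C
  dual_dual : ∀ A : C, dual (dual A) = A
  basis : ∀ A : C, DaggerDualFrobenius A (dual A)
  dualiser_permutation : ∀ A : C,
    IsPermutation (basis A).toDaggerFrobenius (basis (dual A)).toDaggerFrobenius (basis A).dualiser
  dualiser_dual : ∀ A : C,
    (basis (dual A)).dualiser ≫ eqToHom (dual_dual A) = DaggerSMC.dagger (basis A).dualiser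

/-! ### Types of diagrams -/

/-- The orientation of a wire: `up` is a wire of type `A`, `down` a wire of type `A*`. -/
inductive Dir : Type
  | up
  | down

def Dir.flip : Dir → Dir
  | up => down
  | down => up

/-- The formal tensor expressions in `A` and `A*`, which are the types of diagrams. -/
inductive Ty : Type
  | unit : Ty
  | of : Dir → Ty
  | tensor : Ty → Ty → Ty

/-- The positions of the wires in a tensor expression. -/
def Ty.Leaf : Ty → Type
  | unit => Empty
  | of _ => Unit
  | tensor X Y => X.Leaf ⊕ Y.Leaf

/-- The list of orientations of the wires of a tensor expression, from left to right. -/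
def Ty.word : Ty → List Dir
  | unit => []
  | of b => [b]
  | tensor X Y => X.word ++ Y.word

/-- The right-bracketed tensor expression with given orientations. -/
def Ty.ofList : List Dir → Ty
  | [] => unit
  | b :: w => tensor (of b) (ofList w)

/-! ### Diagrams -/

/-- The diagrams built from the `†`-SMC structure (identities, composition, tensor, dagger,
structural isomorphisms; their inverses are their daggers) and the `†`-dual Frobenius structures
`(δ, γ, d)` on `A` and on `A*`. -/
inductive Diagram : Ty → Ty → Type
  | id (X : Ty) : Diagram X X
  | comp {X Y Z : Ty} : Diagram X Y → Diagram Y Z → Diagram X Z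
  | tensor {X Y X' Y' : Ty} : Diagram X Y → Diagram X' Y' → Diagram (X.tensor X') (Y.tensor Y')
  | dag {X Y : Ty} : Diagram X Y → Diagram Y X
  | assoc (X Y Z : Ty) : Diagram ((X.tensor Y).tensor Z) (X.tensor (Y.tensor Z))
  | leftUnit (X : Ty) : Diagram (Ty.unit.tensor X) X
  | rightUnit (X : Ty) : Diagram (X.tensor Ty.unit) X
  | swap (X Y : Ty) : Diagram (X.tensor Y) (Y.tensor X)
  | delta (b : Dir) : Diagram (.of b) ((Ty.of b).tensor (.of b))
  | gamma (b : Dir) : Diagram (.of b) .unit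
  | dualiser (b : Dir) : Diagram (.of b) (.of b.flip)

/-! ### The underlying graph of a diagram, and connectedness -/

/-- A graph whose nodes are the dots and the wire pieces of a diagram with inputs `X` and
outputs `Y`; `inp` and `out` tell at which node each input and each output is attached. -/
structure OpenGraph (X Y : Ty) where
  Node : Type
  graph : SimpleGraph Node
  inp : X.Leaf → Node
  out : Y.Leaf → Node

namespace OpenGraph

/-- A collection of wires: one node for each wire, and no edges. -/
def wires {X Y : Ty} (e : X.Leaf ≃ Y.Leaf) : OpenGraph X Y where
  Node := X.Leaf
  graph := ⊥
  inp := fun x => x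
  out := e.symm

/-- A single dot to which all inputs and outputs are attached. -/
def dot (X Y : Ty) : OpenGraph X Y where
  Node := Unit
  graph := ⊥
  inp := fun _ => ()
  out := fun _ => ()

/-- Sequential composition: each output of `G` is joined by an edge to the matching input of
`H`. -/
def comp {X Y Z : Ty} (G : OpenGraph X Y) (H : OpenGraph Y Z) : OpenGraph X Z where
  Node := G.Node ⊕ H.Node
  graph := SimpleGraph.sum G.graph H.graph ⊔
    SimpleGraph.fromRel fun a b => ∃ y : Y.Leaf, a = Sum.inl (G.out y) ∧ b = Sum.inr (H.inp y)
  inp := fun x => Sum.inl (G.inp x)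
  out := fun z => Sum.inr (H.out z)

/-- Parallel composition. -/
def tensor {X Y X' Y' : Ty} (G : OpenGraph X Y) (H : OpenGraph X' Y') :
    OpenGraph (X.tensor X') (Y.tensor Y') where
  Node := G.Node ⊕ H.Node
  graph := SimpleGraph.sum G.graph H.graph
  inp := Sum.map G.inp H.inp
  out := Sum.map G.out H.out

/-- Vertical reflection. -/
def dag {X Y : Ty} (G : OpenGraph X Y) : OpenGraph Y X where
  Node := G.Node
  graph := G.graph
  inp := G.out
  out := G.inp

end OpenGraph

namespace Diagram

/-- The underlying graph of a diagram. -/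
def toGraph : {X Y : Ty} → Diagram X Y → OpenGraph X Y
  | _, _, id X => OpenGraph.wires (Equiv.refl X.Leaf)
  | _, _, comp f g => f.toGraph.comp g.toGraph
  | _, _, tensor f g => f.toGraph.tensor g.toGraph
  | _, _, dag f => f.toGraph.dag
  | _, _, assoc X Y Z => OpenGraph.wires (Equiv.sumAssoc X.Leaf Y.Leaf Z.Leaf)
  | _, _, leftUnit X => OpenGraph.wires (Equiv.emptySum Empty X.Leaf)
  | _, _, rightUnit X => OpenGraph.wires (Equiv.sumEmpty X.Leaf Empty)
  | _, _, swap X Y => OpenGraph.wires (Equiv.sumComm X.Leaf Y.Leaf)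
  | _, _, delta _ => OpenGraph.dot _ _
  | _, _, gamma _ => OpenGraph.dot _ _
  | _, _, dualiser _ => OpenGraph.dot _ _

/-- A diagram is connected if its underlying graph is (in particular it is not empty). -/
def Connected {X Y : Ty} (Ξ : Diagram X Y) : Prop :=
  Ξ.toGraph.graph.Connected

end Diagram

/-! ### Interpretation of diagrams -/

section Interpretation

variable {C : Type u} [Category.{v} C] [MonoidalCategory C] [SymmetricCategory C] [DaggerSMC C]
  [DaggerCompactWithBases C]

/-- The object `A` or `A*`. -/
def Dir.interp (A : C) : Dir → C
  | up => A
  | down => DaggerCompactWithBases.dual A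

/-- The object denoted by a tensor expression in `A` and `A*`. -/
def Ty.interp (A : C) : Ty → C
  | unit => 𝟙_ C
  | of b => b.interp A
  | tensor X Y => X.interp A ⊗ Y.interp A

/-- The dualisers `d_A : A ⟶ A*` and `d_{A*} : A* ⟶ A** = A`. -/
def Dir.dualiser (A : C) : (b : Dir) → (b.interp A ⟶ b.flip.interp A)
  | up => (DaggerCompactWithBases.basis A).dualiser
  | down => (DaggerCompactWithBases.basis (DaggerCompactWithBases.dual A)).dualiser ≫
      eqToHom (DaggerCompactWithBases.dual_dual A)

/-- The morphism denoted by a diagram. -/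
def Diagram.interp (A : C) : {X Y : Ty} → Diagram X Y → (X.interp A ⟶ Y.interp A)
  | _, _, .id X => 𝟙 (X.interp A)
  | _, _, .comp f g => f.interp A ≫ g.interp A
  | _, _, .tensor f g => f.interp A ⊗ₘ g.interp A
  | _, _, .dag f => DaggerSMC.dagger (f.interp A)
  | _, _, .assoc X Y Z => (α_ (X.interp A) (Y.interp A) (Z.interp A)).hom
  | _, _, .leftUnit X => (λ_ (X.interp A)).hom
  | _, _, .rightUnit X => (ρ_ (X.interp A)).hom
  | _, _, .swap X Y => (β_ (X.interp A) (Y.interp A)).hom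
  | _, _, .delta b => (DaggerCompactWithBases.basis (b.interp A)).comul
  | _, _, .gamma b => (DaggerCompactWithBases.basis (b.interp A)).counit
  | _, _, .dualiser b => b.dualiser A

end Interpretation

/-! ### Spiders with directed legs -/

/-- A leg of a spider whose body is a dot of type `A`: a plain wire for an `up` leg, the dualiser
`d_{A*} : A* ⟶ A` for a `down` leg. -/
def leg : (b : Dir) → Diagram (.of b) (.of .up)
  | .up => .id (.of .up)
  | .down => .dualiser .down

/-- Merging legs with orientations `w` into one wire by iterating `δ†`, starting from `γ†`. -/
def merge : (w : List Dir) → Diagram (Ty.ofList w) (.of .up)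
  | [] => .dag (.gamma .up)
  | b :: w => ((leg b).tensor (merge w)).comp (.dag (.delta .up))

/-- The spider with directed legs, with input orientations `w` and output orientations `w'`. -/
def spider (w w' : List Dir) : Diagram (Ty.ofList w) (Ty.ofList w') :=
  (merge w).comp (.dag (merge w'))

/-- The canonical rebracketing of a tensor of two right-bracketed expressions. -/
def append : (w w' : List Dir) →
    Diagram ((Ty.ofList w).tensor (Ty.ofList w')) (Ty.ofList (w ++ w'))
  | [], w' => .leftUnit (Ty.ofList w')
  | b :: w, w' => (Diagram.assoc (.of b) (Ty.ofList w) (Ty.ofList w')).comp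
      ((Diagram.id (.of b)).tensor (append w w'))

/-- The canonical rebracketing of a tensor expression to a right-bracketed one. -/
def flatten : (X : Ty) → Diagram X (Ty.ofList X.word)
  | .unit => .id .unit
  | .of b => .dag (.rightUnit (.of b))
  | .tensor X Y => ((flatten X).tensor (flatten Y)).comp (append X.word Y.word)

/-- The canonical rebracketing between two tensor expressions with the same wires. -/
def rebracket {X X' : Ty} (h : X.word = X'.word) : Diagram X X' :=
  (h ▸ flatten X : Diagram X (Ty.ofList X'.word)).comp (.dag (flatten X'))

end OrientedSpider

/-!
The dual of the comonoid `(δ, γ)` is a commutative monoid `(μ, η) = (δ†, γ†)`, and among commutative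
monoids the tensor product is a coproduct. Since the dualisers are isomorphisms of monoids, the
object denoted by a tensor expression `X` is a coproduct of copies of `A`, one for each wire of
`X`, whatever the orientations. Hence every function `k` from the wires of `X` to those of `Y`
induces a homomorphism `push k`, homomorphisms are determined by their restrictions to the wires
(`Ty.hom_ext`), and all structural isomorphisms, multiplications, units and dualisers are of the
form `push k`; the generators `δ`, `γ` are daggers of such. The orientations and the coherence
isomorphisms disappear from the rest of the argument.

The Frobenius law enters as Frobenius reciprocity (`IsFrobHom`): the dagger of `push k` is a
homomorphism of modules. It implies the key identity `dagger_comp_eq_link`: the composite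
`(push q)† ≫ push p` equals the operator which puts both sides next to each other and multiplies by
the states that equate `q y` with `p y` for each wire `y`. So, by induction, every diagram,
connected or not, has the form `push inp ≫ Φ ≫ (push out)†`, where `Φ` is an operator on one wire
for each node of the underlying graph, which does not distinguish the two ends of any edge
(`Diagram.realization`). If the graph is connected, `Φ` does not distinguish any two nodes, and the
specialness law `δ ≫ δ† = 1` forces the composite to be the merging of all inputs followed by the
splitting into all outputs (`Identifies.push_comp_comp_dagger_push`), which is the spider.
-/

namespace OrientedSpider

open MonObj DaggerSMC

set_option linter.unusedSectionVars false

-- Mathlib has a second, definitionally equal monoid structure on `M ⊗ N`, from the category `Mon C`;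
-- this one has the lemmas `tensorObj.one_def` and `tensorObj.mul_def`.
attribute [local instance] MonObj.tensorObj.instTensorObj

local postfix:max "†" => DaggerSMC.dagger

section Dagger

/-! ### Daggers and unitary morphisms -/

variable {C : Type u} [Category.{v} C] [MonoidalCategory C] [SymmetricCategory C] [DaggerSMC C]

attribute [simp] dagger_id dagger_comp dagger_dagger dagger_associator
  dagger_leftUnitor dagger_rightUnitor dagger_braiding

@[simp]
lemma dagger_whiskerLeft (P : C) {Q R : C} (f : Q ⟶ R) : (P ◁ f)† = P ◁ f† := by
  rw [← id_tensorHom, dagger_tensor, dagger_id, id_tensorHom]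

@[simp]
lemma dagger_whiskerRight {Q R : C} (f : Q ⟶ R) (P : C) : (f ▷ P)† = f† ▷ P := by
  rw [← tensorHom_id, dagger_tensor, dagger_id, tensorHom_id]

attribute [simp] dagger_tensor

@[simp]
lemma dagger_associator_inv (P Q R : C) : (α_ P Q R).inv† = (α_ P Q R).hom := by
  rw [← dagger_associator, dagger_dagger]

@[simp]
lemma dagger_leftUnitor_inv (P : C) : (λ_ P).inv† = (λ_ P).hom := by
  rw [← dagger_leftUnitor, dagger_dagger]

@[simp]
lemma dagger_rightUnitor_inv (P : C) : (ρ_ P).inv† = (ρ_ P).hom := by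
  rw [← dagger_rightUnitor, dagger_dagger]

lemma dagger_injective {P Q : C} {f g : P ⟶ Q} (h : f† = g†) : f = g := by
  rw [← dagger_dagger f, h, dagger_dagger]

lemma IsUnitary.comp {P Q R : C} {f : P ⟶ Q} {g : Q ⟶ R} (hf : IsUnitary f) (hg : IsUnitary g) :
    IsUnitary (f ≫ g) := by
  constructor
  · rw [dagger_comp, Category.assoc, reassoc_of% hg.1, hf.1]
  · rw [dagger_comp, Category.assoc, reassoc_of% hf.2, hg.2]

lemma IsUnitary.tensor {P Q R S : C} {f : P ⟶ Q} {g : R ⟶ S} (hf : IsUnitary f)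
    (hg : IsUnitary g) : IsUnitary (f ⊗ₘ g) := by
  constructor
  · rw [dagger_tensor, tensorHom_comp_tensorHom, hf.1, hg.1, id_tensorHom_id]
  · rw [dagger_tensor, tensorHom_comp_tensorHom, hf.2, hg.2, id_tensorHom_id]

lemma IsUnitary.dagger {P Q : C} {f : P ⟶ Q} (hf : IsUnitary f) : IsUnitary f† :=
  ⟨by rw [dagger_dagger, hf.2], by rw [dagger_dagger, hf.1]⟩

lemma isUnitary_id (P : C) : IsUnitary (𝟙 P) := by simp [IsUnitary]
lemma isUnitary_associator (P Q R : C) : IsUnitary (α_ P Q R).hom := by simp [IsUnitary]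
lemma isUnitary_leftUnitor (P : C) : IsUnitary (λ_ P).hom := by simp [IsUnitary]
lemma isUnitary_rightUnitor (P : C) : IsUnitary (ρ_ P).hom := by simp [IsUnitary]

lemma dagger_tensorμ (P Q R S : C) : (tensorμ P Q R S)† = tensorδ P Q R S := by
  simp [tensorμ, tensorδ]

lemma isUnitary_tensorμ (P Q R S : C) : IsUnitary (tensorμ P Q R S) := by
  simp [IsUnitary, dagger_tensorμ]

/-! ### Homomorphisms satisfying Frobenius reciprocity -/

/-- A monoid homomorphism satisfying Frobenius reciprocity, that is, whose dagger is a
homomorphism of modules over its source: in terms of elements, `f† (f y * x) = y * f† x`. -/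
class IsFrobHom {P Q : C} [MonObj P] [MonObj Q] (f : P ⟶ Q) : Prop extends IsMonHom f where
  reciprocity : f ▷ Q ≫ μ ≫ f† = P ◁ f† ≫ μ

section

variable {P Q R S : C} [MonObj P] [MonObj Q] [MonObj R] [MonObj S]

instance (P : C) [MonObj P] : IsFrobHom (𝟙 P) where
  reciprocity := by simp

instance (f : P ⟶ Q) (g : Q ⟶ R) [IsFrobHom f] [IsFrobHom g] : IsFrobHom (f ≫ g) where
  reciprocity := by
    rw [comp_whiskerRight, dagger_comp, Category.assoc, reassoc_of% IsFrobHom.reciprocity,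
      ← whisker_exchange_assoc, IsFrobHom.reciprocity, whiskerLeft_comp, Category.assoc]

instance (f : P ⟶ Q) (g : R ⟶ S) [IsFrobHom f] [IsFrobHom g] : IsFrobHom (f ⊗ₘ g) where
  reciprocity := by
    have hf := IsFrobHom.reciprocity (f := f)
    have hg := IsFrobHom.reciprocity (f := g)
    rw [tensorObj.mul_def, tensorObj.mul_def, dagger_tensor]
    rw [Category.assoc, tensorμ_natural_left_assoc, tensorHom_comp_tensorHom,
      tensorHom_comp_tensorHom, hf, hg, tensorμ_natural_right_assoc, tensorHom_comp_tensorHom]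

lemma IsFrobHom.of_isUnitary (f : P ⟶ Q) [IsMonHom f] (hf : IsUnitary f) : IsFrobHom f where
  reciprocity := by
    have h : f ▷ Q ≫ μ = P ◁ f† ≫ μ ≫ f := by
      rw [IsMonHom.mul_hom, ← id_tensorHom, tensorHom_comp_tensorHom_assoc, hf.2, Category.id_comp,
        tensorHom_id]
    rw [reassoc_of% h, hf.1, Category.comp_id]

end

/-! ### Special commutative `†`-Frobenius monoids -/

/-- A special commutative `†`-Frobenius monoid. Instead of the Frobenius law itself, the condition
is that `μ : P ⊗ P ⟶ P` satisfies Frobenius reciprocity, which is the form stable under tensor products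
without further coherence; see `mul_reciprocity_of_frobenius`. -/
class IsDaggerFrobenius (P : C) [MonObj P] : Prop extends IsCommMonObj P where
  special : μ† ≫ μ = 𝟙 P
  mul_reciprocity : μ ▷ P ≫ μ ≫ μ† = (P ⊗ P) ◁ μ† ≫ μ

section

variable {P Q R S : C} [MonObj P] [MonObj Q] [MonObj R] [MonObj S]

instance [IsCommMonObj P] : IsMonHom μ[P] where
  one_hom := by simp [tensorObj.one_def, ← unitors_equal]
  mul_hom := by simp [tensorObj.mul_def]

instance [IsDaggerFrobenius P] : IsFrobHom μ[P] where
  reciprocity := IsDaggerFrobenius.mul_reciprocity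

instance : IsFrobHom η[P] where
  one_hom := by simp
  mul_hom := by simp [unitors_equal]
  reciprocity := by simp

instance : IsMonHom (tensorμ P Q R S) := by
  unfold tensorμ
  infer_instance

instance : IsDaggerFrobenius (𝟙_ C) where
  special := by simp
  mul_reciprocity := by
    have := IsFrobHom.of_isUnitary (λ_ (𝟙_ C)).hom (isUnitary_leftUnitor _)
    exact IsFrobHom.reciprocity (f := (λ_ (𝟙_ C)).hom)

instance [IsDaggerFrobenius P] [IsDaggerFrobenius Q] : IsDaggerFrobenius (P ⊗ Q) where
  special := by
    rw [tensorObj.mul_def, dagger_comp, Category.assoc, reassoc_of% (isUnitary_tensorμ P Q P Q).2,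
      dagger_tensor, tensorHom_comp_tensorHom, IsDaggerFrobenius.special, IsDaggerFrobenius.special,
      id_tensorHom_id]
  mul_reciprocity := by
    have := IsFrobHom.of_isUnitary (tensorμ P Q P Q) (isUnitary_tensorμ P Q P Q)
    exact IsFrobHom.reciprocity (f := tensorμ P Q P Q ≫ (μ[P] ⊗ₘ μ[Q]))

/-- Frobenius reciprocity for a multiplication is a consequence of the Frobenius law and
commutativity: `δ (a * b * c)` is `(a * c₁, b * c₂)`. -/
lemma mul_reciprocity_of_frobenius [IsCommMonObj P]
    (h : μ[P] ≫ μ[P]† = P ◁ μ[P]† ≫ (α_ P P P).inv ≫ μ[P] ▷ P) :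
    μ[P] ▷ P ≫ μ ≫ μ[P]† = (P ⊗ P) ◁ μ[P]† ≫ μ := by
  -- cocommutativity
  have hc : μ[P]† ≫ (β_ P P).hom = μ[P]† := by
    apply dagger_injective; simp
  -- the mirrored form `δ (b * c) = (c₁, b * c₂)` of the Frobenius law
  have h' : μ[P] ≫ μ[P]† = P ◁ μ[P]† ≫ (α_ P P P).inv ≫ (β_ P P).hom ▷ P ≫ (α_ P P P).hom ≫
      P ◁ μ[P] := by
    have hb : P ◁ (β_ P P).hom ≫ (α_ P P P).inv ≫ (β_ (P ⊗ P) P).hom =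
        (α_ P P P).inv ≫ (β_ P P).hom ▷ P ≫ (α_ P P P).hom := by
      simp [BraidedCategory.braiding_tensor_left_hom, ← whiskerLeft_comp_assoc]
    calc μ[P] ≫ μ[P]†
        = P ◁ (μ[P]† ≫ (β_ P P).hom) ≫ (α_ P P P).inv ≫ μ[P] ▷ P ≫ (β_ P P).hom := by
          rw [hc, ← reassoc_of% h, hc]
      _ = _ := by
          rw [BraidedCategory.braiding_naturality_left, whiskerLeft_comp_assoc, reassoc_of% hb]
  rw [MonObj.mul_assoc_assoc, h]
  rw [← whiskerLeft_comp_assoc, h', tensorObj.mul_def]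
  simp [tensorμ, tensorHom_def']

/-! ### Multiplication by a state -/

/-- Multiplication by a state `φ : 𝟙_ C ⟶ P` of a monoid `P`. -/
def act (φ : 𝟙_ C ⟶ P) : P ⟶ P := (λ_ P).inv ≫ φ ▷ P ≫ μ

lemma act_one : act η[P] = 𝟙 P := by simp [act]

lemma act_comp_hom (φ : 𝟙_ C ⟶ P) (f : P ⟶ Q) [IsMonHom f] :
    act φ ≫ f = f ≫ act (φ ≫ f) := by
  simp only [act, Category.assoc, IsMonHom.mul_hom, comp_whiskerRight]
  rw [leftUnitor_inv_naturality_assoc, MonoidalCategory.tensorHom_def',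
    whisker_exchange_assoc, Category.assoc]

lemma act_comp_dagger (φ : 𝟙_ C ⟶ P) (f : P ⟶ Q) [IsFrobHom f] :
    act (φ ≫ f) ≫ f† = f† ≫ act φ := by
  simp only [act, Category.assoc, comp_whiskerRight, IsFrobHom.reciprocity]
  rw [leftUnitor_inv_naturality_assoc, whisker_exchange_assoc]

lemma act_eq_rightUnitor_inv [IsCommMonObj P] (φ : 𝟙_ C ⟶ P) :
    act φ = (ρ_ P).inv ≫ P ◁ φ ≫ μ := by
  rw [act, ← IsCommMonObj.mul_comm P, BraidedCategory.braiding_naturality_left_assoc]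
  simp

/-- A homomorphism followed by its dagger is multiplication by the state `f† 1`. -/
lemma comp_dagger_eq_act [IsCommMonObj P] (f : P ⟶ Q) [IsFrobHom f] :
    f ≫ f† = act (η ≫ f†) := by
  rw [act_eq_rightUnitor_inv, whiskerLeft_comp_assoc, ← IsFrobHom.reciprocity,
    whisker_exchange_assoc, ← rightUnitor_inv_naturality_assoc]
  simp

lemma mul_act (φ : 𝟙_ C ⟶ P) : μ ≫ act φ = act φ ▷ P ≫ μ := by
  simp only [act, leftUnitor_inv_naturality_assoc, whisker_exchange_assoc,
    MonObj.mul_assoc_flip, comp_whiskerRight, Category.assoc]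
  simp

/-- Multiplication by `φ ⊗ 1` acts on the first factor only. -/
lemma act_tensor_one (φ : 𝟙_ C ⟶ P) : act (φ ≫ (ρ_ P).inv ≫ P ◁ η[Q]) = act φ ▷ Q := by
  have h : φ ≫ (ρ_ P).inv ≫ P ◁ η[Q] = (λ_ (𝟙_ C)).inv ≫ (φ ⊗ₘ η) := by
    rw [rightUnitor_inv_naturality_assoc, ← unitors_inv_equal, MonoidalCategory.tensorHom_def]
  rw [act, h, tensorObj.mul_def, comp_whiskerRight_assoc, tensorμ_natural_left_assoc,
    Iso.inv_comp_eq, tensor_left_unitality]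
  simp only [Category.assoc, ← tensorHom_id, tensorHom_comp_tensorHom]
  simp [act]

lemma act_comp_comul [IsDaggerFrobenius P] (φ : 𝟙_ C ⟶ P) :
    act φ ≫ μ[P]† = μ[P]† ≫ act φ ▷ P := by
  rw [← act_tensor_one, ← act_comp_dagger]
  simp

/-! ### Coproduct injections -/

variable (P Q) in
/-- The left coproduct injection `P ⟶ P ⊗ Q` of commutative monoids. -/
def inl : P ⟶ P ⊗ Q := (ρ_ P).inv ≫ P ◁ η

variable (P Q) in
/-- The right coproduct injection `Q ⟶ P ⊗ Q` of commutative monoids. -/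
def inr : Q ⟶ P ⊗ Q := (λ_ Q).inv ≫ η ▷ Q

instance : IsFrobHom (inl P Q) := by
  have := IsFrobHom.of_isUnitary (ρ_ P).inv
    (dagger_rightUnitor P ▸ (isUnitary_rightUnitor P).dagger)
  have : IsFrobHom (P ◁ η[Q]) := by rw [← id_tensorHom]; infer_instance
  unfold inl; infer_instance

instance : IsFrobHom (inr P Q) := by
  have := IsFrobHom.of_isUnitary (λ_ Q).inv
    (dagger_leftUnitor Q ▸ (isUnitary_leftUnitor Q).dagger)
  have : IsFrobHom (η[P] ▷ Q) := by rw [← tensorHom_id]; infer_instance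
  unfold inr; infer_instance

lemma inl_tensor_inr_mul : (inl P Q ⊗ₘ inr P Q) ≫ μ = 𝟙 (P ⊗ Q) := by
  have h : ((ρ_ P).inv ⊗ₘ (λ_ Q).inv) ≫ tensorμ P (𝟙_ C) (𝟙_ C) Q ≫
      ((ρ_ P).hom ⊗ₘ (λ_ Q).hom) = 𝟙 _ := by
    simp only [tensorμ, braiding_tensorUnit_left]
    monoidal
  rw [tensorObj.mul_def, inl, inr, ← tensorHom_comp_tensorHom_assoc, ← id_tensorHom, ← tensorHom_id,
    tensorμ_natural_assoc, tensorHom_comp_tensorHom]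
  simpa using h

lemma inl_tensor (f : P ⟶ R) (g : Q ⟶ S) [IsMonHom g] : inl P Q ≫ (f ⊗ₘ g) = f ≫ inl R S := by
  rw [inl, inl, Category.assoc, rightUnitor_inv_naturality_assoc, MonoidalCategory.tensorHom_def',
    ← whiskerLeft_comp_assoc, IsMonHom.one_hom, whisker_exchange]

lemma inr_tensor (f : P ⟶ R) (g : Q ⟶ S) [IsMonHom f] : inr P Q ≫ (f ⊗ₘ g) = g ≫ inr R S := by
  rw [inr, inr, Category.assoc, leftUnitor_inv_naturality_assoc, MonoidalCategory.tensorHom_def,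
    ← comp_whiskerRight_assoc, IsMonHom.one_hom, whisker_exchange]

lemma inl_mul : inl P P ≫ μ = 𝟙 P := by simp [inl]

lemma inr_mul : inr P P ≫ μ = 𝟙 P := by simp [inr]

lemma inl_desc (f : P ⟶ R) (g : Q ⟶ R) [IsMonHom g] : inl P Q ≫ (f ⊗ₘ g) ≫ μ = f := by
  rw [reassoc_of% inl_tensor, inl_mul, Category.comp_id]

lemma inr_desc (f : P ⟶ R) (g : Q ⟶ R) [IsMonHom f] : inr P Q ≫ (f ⊗ₘ g) ≫ μ = g := by
  rw [reassoc_of% inr_tensor, inr_mul, Category.comp_id]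

/-- A homomorphism out of `P ⊗ Q` is determined by its restrictions to the factors. -/
lemma eq_desc (f : P ⊗ Q ⟶ R) [IsMonHom f] : f = (inl P Q ≫ f ⊗ₘ inr P Q ≫ f) ≫ μ := by
  rw [← tensorHom_comp_tensorHom, Category.assoc, ← IsMonHom.mul_hom, ← Category.assoc,
    inl_tensor_inr_mul, Category.id_comp]

/-! ### Linking two legs -/

/-- For homomorphisms `f g : P ⟶ Q`, the operator on `Q` which equates the image of `f` with that of
`g`: multiplication by the state obtained from the cup `η ≫ μ†` on `P` by applying `f` and `g` to
its two legs and multiplying them. -/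
def link (f g : P ⟶ Q) : Q ⟶ Q := act (η ≫ μ† ≫ (f ⊗ₘ g) ≫ μ)

section

variable (f g : P ⟶ Q) [IsDaggerFrobenius P] [IsDaggerFrobenius Q] [IsFrobHom f] [IsFrobHom g]

lemma act_cup : act (η[P] ≫ μ†) = μ ≫ μ† := by
  have := comp_dagger_eq_act μ[P]
  rw [← this]

lemma comp_link_left : f ≫ link f g = μ† ≫ (f ⊗ₘ g) ≫ μ := by
  conv_lhs => enter [1]; rw [← inl_desc f g]
  rw [link, ← Category.assoc η, Category.assoc, ← act_comp_hom, act_cup, Category.assoc,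
    reassoc_of% inl_mul]

lemma link_comp_dagger_left : link f g ≫ f† = ((f ⊗ₘ g) ≫ μ)† ≫ μ := by
  have h := congrArg dagger (inl_mul (P := P))
  rw [dagger_comp, dagger_id] at h
  conv_lhs => enter [2]; rw [← inl_desc f g, dagger_comp]
  rw [link, ← Category.assoc η, ← Category.assoc, act_comp_dagger, act_cup, Category.assoc,
    Category.assoc, h, Category.comp_id]

lemma comp_link_right : g ≫ link f g = μ† ≫ (f ⊗ₘ g) ≫ μ := by
  conv_lhs => enter [1]; rw [← inr_desc f g]
  rw [link, ← Category.assoc η, Category.assoc, ← act_comp_hom, act_cup, Category.assoc,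
    reassoc_of% inr_mul]

lemma link_comp_dagger_right : link f g ≫ g† = ((f ⊗ₘ g) ≫ μ)† ≫ μ := by
  have h := congrArg dagger (inr_mul (P := P))
  rw [dagger_comp, dagger_id] at h
  conv_lhs => enter [2]; rw [← inr_desc f g, dagger_comp]
  rw [link, ← Category.assoc η, ← Category.assoc, act_comp_dagger, act_cup, Category.assoc,
    Category.assoc, h, Category.comp_id]

/-- If `t` does not distinguish `f` from `g`, it sends the state defining `link f g` to the unit:
the two legs of the cup are multiplied before applying `f ≫ t`, and specialness applies. -/
lemma link_state_comp (t : Q ⟶ R) [IsMonHom t] (h : f ≫ t = g ≫ t) :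
    (η[P] ≫ μ† ≫ (f ⊗ₘ g) ≫ μ) ≫ t = η := by
  simp only [Category.assoc, IsMonHom.mul_hom, tensorHom_comp_tensorHom_assoc, h]
  rw [← IsMonHom.mul_hom, reassoc_of% IsDaggerFrobenius.special, IsMonHom.one_hom]

lemma link_comp (t : Q ⟶ R) [IsMonHom t] (h : f ≫ t = g ≫ t) : link f g ≫ t = t := by
  rw [link, act_comp_hom, link_state_comp f g t h, act_one, Category.comp_id]

lemma dagger_comp_link (t : Q ⟶ R) [IsFrobHom t] (h : f ≫ t = g ≫ t) :
    t† ≫ link f g = t† := by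
  rw [link, ← act_comp_dagger, link_state_comp f g t h, act_one, Category.id_comp]

/-- Plugging outputs into inputs is the same as putting the two sides next to each other and
linking the outputs of the first to the inputs of the second. -/
lemma dagger_comp_eq_link [IsDaggerFrobenius R] (f : P ⟶ Q) (g : P ⟶ R) [IsFrobHom f]
    [IsFrobHom g] :
    f† ≫ g = inl Q R ≫ link (f ≫ inl Q R) (g ≫ inr Q R) ≫ (inr Q R)† := by
  have h : link (f ≫ inl Q R) (g ≫ inr Q R) = act ((η[P] ≫ μ†) ≫ (f ⊗ₘ g)) := by
    rw [link, ← tensorHom_comp_tensorHom_assoc, inl_tensor_inr_mul, Category.comp_id,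
      Category.assoc]
  -- `g` can be moved past the operator by naturality, and `f†` by reciprocity; what remains is the
  -- snake identity `inl ≫ act cup ≫ inr† = 𝟙` on `P`
  have hcup : η[P] ≫ μ† ≫ (f ⊗ₘ g) = ((η[P] ≫ μ†) ≫ (f ⊗ₘ 𝟙 P)) ≫ (𝟙 Q ⊗ₘ g) := by
    simp only [Category.assoc, tensorHom_comp_tensorHom, Category.comp_id, Category.id_comp]
  have hinl : inl Q R = inl Q P ≫ (𝟙 Q ⊗ₘ g) := by rw [inl_tensor, Category.id_comp]
  have hinr : (inr Q P)† = (f ⊗ₘ 𝟙 P)† ≫ (inr P P)† := by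
    rw [← dagger_comp, inr_tensor, Category.id_comp]
  have hg : (𝟙 Q ⊗ₘ g) ≫ (inr Q R)† = (inr Q P)† ≫ g := by
    simp [inr, whisker_exchange_assoc]
  have hf : inl Q P ≫ (f ⊗ₘ 𝟙 P)† = f† ≫ inl P P := by
    rw [dagger_tensor, dagger_id, tensorHom_id, inl, inl, Category.assoc, whisker_exchange,
      rightUnitor_inv_naturality_assoc]
  have hμ : μ[P]† ≫ (inr P P)† = 𝟙 P := by rw [← dagger_comp, inr_mul, dagger_id]
  rw [h, Category.assoc, hcup, hinl, Category.assoc, ← reassoc_of% act_comp_hom, hg, hinr,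
    Category.assoc (f ⊗ₘ 𝟙 P)†, reassoc_of% act_comp_dagger, act_cup, reassoc_of% hf,
    Category.assoc, reassoc_of% hμ, reassoc_of% inl_mul]

end

/-! ### Module endomorphisms -/

/-- An endomorphism of `P` as a module and as a comodule over itself. -/
structure IsModuleEnd (Φ : P ⟶ P) : Prop where
  mul_comp : μ ≫ Φ = Φ ▷ P ≫ μ
  comp_comul : Φ ≫ μ[P]† = μ[P]† ≫ Φ ▷ P

namespace IsModuleEnd

lemma id : IsModuleEnd (𝟙 P) := ⟨by simp, by simp⟩

lemma act [IsDaggerFrobenius P] (φ : 𝟙_ C ⟶ P) : IsModuleEnd (act φ) :=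
  ⟨mul_act φ, act_comp_comul φ⟩

variable {Φ Ψ : P ⟶ P}

lemma comp (hΦ : IsModuleEnd Φ) (hΨ : IsModuleEnd Ψ) : IsModuleEnd (Φ ≫ Ψ) :=
  ⟨by rw [reassoc_of% hΦ.mul_comp, hΨ.mul_comp, comp_whiskerRight_assoc],
   by rw [Category.assoc, hΨ.comp_comul, reassoc_of% hΦ.comp_comul, comp_whiskerRight]⟩

lemma dagger (hΦ : IsModuleEnd Φ) : IsModuleEnd Φ† :=
  ⟨by simpa using congrArg DaggerSMC.dagger hΦ.comp_comul,
   by simpa using congrArg DaggerSMC.dagger hΦ.mul_comp⟩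

lemma tensor {Χ : Q ⟶ Q} (hΦ : IsModuleEnd Φ) (hΧ : IsModuleEnd Χ) : IsModuleEnd (Φ ⊗ₘ Χ) where
  mul_comp := by
    rw [tensorObj.mul_def, Category.assoc, tensorHom_comp_tensorHom, hΦ.mul_comp, hΧ.mul_comp,
      tensorμ_natural_left_assoc, tensorHom_comp_tensorHom]
  comp_comul := by
    apply dagger_injective
    have h := congrArg DaggerSMC.dagger hΦ.comp_comul
    have h' := congrArg DaggerSMC.dagger hΧ.comp_comul
    simp only [dagger_comp, dagger_dagger, dagger_whiskerRight] at h h'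
    rw [dagger_comp, dagger_comp, dagger_dagger, dagger_whiskerRight, dagger_tensor,
      tensorObj.mul_def, Category.assoc, tensorHom_comp_tensorHom, h, h',
      tensorμ_natural_left_assoc, tensorHom_comp_tensorHom]

section

variable [IsCommMonObj P]

lemma mul_comp' (hΦ : IsModuleEnd Φ) : μ ≫ Φ = P ◁ Φ ≫ μ := by
  rw [← IsCommMonObj.mul_comm P, Category.assoc, hΦ.mul_comp,
    ← BraidedCategory.braiding_naturality_right_assoc]

lemma comm (hΦ : IsModuleEnd Φ) (hΨ : IsModuleEnd Ψ) : Φ ≫ Ψ = Ψ ≫ Φ := by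
  have h : μ[P] ≫ Φ ≫ Ψ = μ[P] ≫ Ψ ≫ Φ := by
    rw [reassoc_of% hΦ.mul_comp', hΨ.mul_comp, whisker_exchange_assoc, ← hΦ.mul_comp',
      ← reassoc_of% hΨ.mul_comp]
  simpa only [reassoc_of% inl_mul] using inl P P ≫= h

end

end IsModuleEnd

/-- When `q† ≫ p` is plugged between two operators, both can be moved next to each other, before the
link between the two sides, since module endomorphisms commute. -/
lemma comp_dagger_comp_comp [IsDaggerFrobenius P] [IsDaggerFrobenius Q] [IsDaggerFrobenius R]
    (q : P ⟶ Q) (p : P ⟶ R) [IsFrobHom q] [IsFrobHom p] {Φ : Q ⟶ Q} {Ψ : R ⟶ R}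
    (hΨ : IsModuleEnd Ψ) :
    (Φ ≫ q†) ≫ p ≫ Ψ =
      inl Q R ≫ ((Φ ⊗ₘ Ψ) ≫ link (q ≫ inl Q R) (p ≫ inr Q R)) ≫ (inr Q R)† := by
  have hΦ' : inl Q R ≫ (Φ ⊗ₘ 𝟙 R) = Φ ≫ inl Q R := inl_tensor _ _
  have hΨ' : (𝟙 Q ⊗ₘ Ψ) ≫ (inr Q R)† = (inr Q R)† ≫ Ψ := by
    simpa using congrArg dagger (inr_tensor (𝟙 Q) Ψ†)
  have hT : Φ ⊗ₘ Ψ = (Φ ⊗ₘ 𝟙 R) ≫ (𝟙 Q ⊗ₘ Ψ) := by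
    rw [tensorHom_comp_tensorHom, Category.comp_id, Category.id_comp]
  have hc := (IsModuleEnd.id.tensor hΨ).comm
    (IsModuleEnd.act (P := Q ⊗ R) (η ≫ μ† ≫ (q ≫ inl Q R ⊗ₘ p ≫ inr Q R) ≫ μ))
  have h := dagger_comp_eq_link q p
  rw [link] at h ⊢
  rw [hT]
  simp only [Category.assoc]
  rw [reassoc_of% hΦ', reassoc_of% hc, hΨ', reassoc_of% h]

/-- The composite of two factorized morphisms is factorized through the tensor product. -/
lemma comp_eq_of_fac [IsDaggerFrobenius P] [IsDaggerFrobenius Q] [IsDaggerFrobenius R]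
    {X Z : C} {f : X ⟶ P} {g : P ⟶ Z} {a : X ⟶ Q} {q : P ⟶ Q} {p : P ⟶ R} {c : Z ⟶ R}
    {Φ : Q ⟶ Q} {Ψ : R ⟶ R} [IsFrobHom q] [IsFrobHom p] (hΨ : IsModuleEnd Ψ)
    (hf : f = a ≫ Φ ≫ q†) (hg : g = p ≫ Ψ ≫ c†) {a' : X ⟶ Q ⊗ R} {q' p' : P ⟶ Q ⊗ R}
    {c' : Z ⟶ Q ⊗ R} (ha : a ≫ inl Q R = a') (hq : q ≫ inl Q R = q') (hp : p ≫ inr Q R = p')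
    (hc : c ≫ inr Q R = c') : f ≫ g = a' ≫ ((Φ ⊗ₘ Ψ) ≫ link q' p') ≫ c'† := by
  subst hf hg ha hq hp hc
  have h := comp_dagger_comp_comp q p (Φ := Φ) hΨ
  simp only [Category.assoc, dagger_comp] at h ⊢
  rw [reassoc_of% h]

end

end Dagger

section Wires

/-! ### Tensor expressions as coproducts of wires -/

variable {C : Type u} [Category.{v} C] [MonoidalCategory C] [SymmetricCategory C] [DaggerSMC C]

/-- The monoid dual to the comonoid of a `†`-Frobenius structure. -/
abbrev DaggerFrobenius.monObj {P : C} (F : DaggerFrobenius P) : MonObj P where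
  one := F.counit†
  mul := F.comul†
  one_mul := by
    have h := congrArg dagger F.counit_comul
    rwa [dagger_comp, dagger_whiskerRight, dagger_leftUnitor_inv] at h
  mul_one := by
    have h := congrArg dagger F.comul_counit
    rwa [dagger_comp, dagger_whiskerLeft, dagger_rightUnitor_inv] at h
  mul_assoc := by
    have h := congrArg dagger F.comul_assoc
    simp only [dagger_comp, dagger_whiskerLeft, dagger_whiskerRight, dagger_associator] at h
    rw [h, Category.assoc, Iso.hom_inv_id_assoc]

lemma DaggerFrobenius.isDaggerFrobenius {P : C} (F : DaggerFrobenius P) :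
    letI := F.monObj
    IsDaggerFrobenius P := by
  let := F.monObj
  have hμ : μ[P] = F.comul† := rfl
  have hμ' : μ[P]† = F.comul := by rw [hμ, dagger_dagger]
  have : IsCommMonObj P := ⟨by
    apply dagger_injective
    rw [dagger_comp, hμ', dagger_braiding, ← SymmetricCategory.braiding_swap_eq_inv_braiding,
      F.comul_comm]⟩
  exact
  { special := by rw [hμ', hμ, F.special]
    mul_reciprocity := mul_reciprocity_of_frobenius (by
      rw [hμ', hμ, F.frobenius, id_tensorHom, tensorHom_id]) }

variable [DaggerCompactWithBases C] (A : C)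

instance Dir.monObj (b : Dir) : MonObj (b.interp A) :=
  (DaggerCompactWithBases.basis (b.interp A)).toDaggerFrobenius.monObj

instance Dir.isDaggerFrobenius (b : Dir) : IsDaggerFrobenius (b.interp A) :=
  (DaggerCompactWithBases.basis (b.interp A)).toDaggerFrobenius.isDaggerFrobenius

instance Ty.monObj : (X : Ty) → MonObj (X.interp A)
  | .unit => inferInstanceAs (MonObj (𝟙_ C))
  | .of b => Dir.monObj A b
  | .tensor X Y =>
    letI := Ty.monObj X
    letI := Ty.monObj Y
    inferInstanceAs (MonObj (X.interp A ⊗ Y.interp A))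

instance Ty.isDaggerFrobenius : (X : Ty) → IsDaggerFrobenius (X.interp A)
  | .unit => inferInstanceAs (IsDaggerFrobenius (𝟙_ C))
  | .of b => Dir.isDaggerFrobenius A b
  | .tensor X Y =>
    letI := Ty.isDaggerFrobenius X
    letI := Ty.isDaggerFrobenius Y
    inferInstanceAs (IsDaggerFrobenius (X.interp A ⊗ Y.interp A))

/-- The isomorphism from `A` to a wire of given orientation: the identity or the dualiser. The
object `A` is written `Dir.up.interp A`, where it carries its monoid structure as an instance. -/
def Dir.ofUp : (b : Dir) → (Dir.up.interp A ⟶ b.interp A)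
  | .up => 𝟙 _
  | .down => Dir.up.dualiser A

lemma Dir.isPermutation_ofUp (b : Dir) : IsPermutation
    (DaggerCompactWithBases.basis (Dir.up.interp A)).toDaggerFrobenius
    (DaggerCompactWithBases.basis (b.interp A)).toDaggerFrobenius (b.ofUp A) := by
  cases b with
  | up => exact ⟨by simp [Dir.ofUp], by simp [Dir.ofUp], isUnitary_id _⟩
  | down => exact DaggerCompactWithBases.dualiser_permutation A

lemma Dir.isUnitary_ofUp (b : Dir) : IsUnitary (b.ofUp A) := (b.isPermutation_ofUp A).unitary

instance (b : Dir) : IsMonHom (b.ofUp A)† where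
  one_hom := by
    have h := congrArg dagger (b.isPermutation_ofUp A).totalMap
    rwa [dagger_comp] at h
  mul_hom := by
    have h := congrArg dagger (b.isPermutation_ofUp A).partialMap
    rwa [dagger_comp, dagger_comp, dagger_tensor] at h

instance (b : Dir) : IsMonHom (b.ofUp A) where
  one_hom := by
    rw [← IsMonHom.one_hom (f := (b.ofUp A)†), Category.assoc, (b.isUnitary_ofUp A).2,
      Category.comp_id]
  mul_hom := by
    have h := IsMonHom.mul_hom (f := (b.ofUp A)†)
    have h' := ((b.ofUp A) ⊗ₘ (b.ofUp A)) ≫= h =≫ b.ofUp A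
    simp only [Category.assoc] at h'
    rw [(b.isUnitary_ofUp A).2, Category.comp_id, tensorHom_comp_tensorHom_assoc,
      (b.isUnitary_ofUp A).1, id_tensorHom_id,
      Category.id_comp] at h'
    exact h'.symm

instance (b : Dir) : IsFrobHom (b.ofUp A) := .of_isUnitary _ (b.isUnitary_ofUp A)

instance (b : Dir) : IsFrobHom (b.ofUp A)† := .of_isUnitary _ (b.isUnitary_ofUp A).dagger

/-- The injection of `A` as the wire at position `x` of a tensor expression. -/
def Ty.ι : (X : Ty) → X.Leaf → (Dir.up.interp A ⟶ X.interp A)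
  | .of b, _ => b.ofUp A
  | .tensor X Y, .inl x => X.ι x ≫ inl (X.interp A) (Y.interp A)
  | .tensor X Y, .inr y => Y.ι y ≫ inr (X.interp A) (Y.interp A)

instance Ty.isFrobHom_ι : (X : Ty) → (x : X.Leaf) → IsFrobHom (X.ι A x)
  | .of b, _ => inferInstanceAs (IsFrobHom (b.ofUp A))
  | .tensor X Y, .inl x => by
    have := X.isFrobHom_ι x
    exact inferInstanceAs (IsFrobHom (X.ι A x ≫ inl (X.interp A) (Y.interp A)))
  | .tensor X Y, .inr y => by
    have := Y.isFrobHom_ι y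
    exact inferInstanceAs (IsFrobHom (Y.ι A y ≫ inr (X.interp A) (Y.interp A)))

variable {A}

/-- The morphism out of `X` with given restriction to each wire: `X` is the coproduct of its wires
among
commutative monoids. -/
def Ty.desc {Q : C} [MonObj Q] : (X : Ty) → (X.Leaf → (Dir.up.interp A ⟶ Q)) → (X.interp A ⟶ Q)
  | .unit, _ => η
  | .of b, f => (b.ofUp A)† ≫ f ()
  | .tensor X Y, f => (X.desc (f ∘ Sum.inl) ⊗ₘ Y.desc (f ∘ Sum.inr)) ≫ μ

lemma Ty.isFrobHom_desc {Q : C} [MonObj Q] [IsDaggerFrobenius Q] :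
    (X : Ty) → (f : X.Leaf → (Dir.up.interp A ⟶ Q)) → (∀ x, IsFrobHom (f x)) →
      IsFrobHom (X.desc f)
  | .unit, _, _ => inferInstanceAs (IsFrobHom η[Q])
  | .of b, f, h => by
    have := h ()
    exact inferInstanceAs (IsFrobHom ((b.ofUp A)† ≫ f ()))
  | .tensor X Y, f, h => by
    have := X.isFrobHom_desc (f ∘ Sum.inl) fun x => h _
    have := Y.isFrobHom_desc (f ∘ Sum.inr) fun x => h _
    exact inferInstanceAs (IsFrobHom ((X.desc (f ∘ Sum.inl) ⊗ₘ Y.desc (f ∘ Sum.inr)) ≫ μ))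

lemma Ty.ι_desc {Q : C} [MonObj Q] [IsDaggerFrobenius Q] :
    (X : Ty) → (f : X.Leaf → (Dir.up.interp A ⟶ Q)) → (∀ x, IsFrobHom (f x)) →
      ∀ x, X.ι A x ≫ X.desc f = f x
  | .of b, f, _, x => by
    change b.ofUp A ≫ (b.ofUp A)† ≫ f () = f ()
    rw [← Category.assoc, (b.isUnitary_ofUp A).1, Category.id_comp]
  | .tensor X Y, f, h, .inl x => by
    have := Y.isFrobHom_desc (f ∘ Sum.inr) fun x => h _
    change (X.ι A x ≫ inl (X.interp A) (Y.interp A)) ≫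
      (X.desc (f ∘ Sum.inl) ⊗ₘ Y.desc (f ∘ Sum.inr)) ≫ μ = _
    rw [Category.assoc, inl_desc]
    exact X.ι_desc (f ∘ Sum.inl) (fun x => h _) x
  | .tensor X Y, f, h, .inr y => by
    have := X.isFrobHom_desc (f ∘ Sum.inl) fun x => h _
    change (Y.ι A y ≫ inr (X.interp A) (Y.interp A)) ≫
      (X.desc (f ∘ Sum.inl) ⊗ₘ Y.desc (f ∘ Sum.inr)) ≫ μ = _
    rw [Category.assoc, inr_desc]
    exact Y.ι_desc (f ∘ Sum.inr) (fun x => h _) y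

/-- Uniqueness of `Ty.desc`. -/
lemma Ty.eq_desc_of {Q : C} [MonObj Q] : (X : Ty) → (g : X.interp A ⟶ Q) → [IsMonHom g] →
      g = X.desc fun x => X.ι A x ≫ g
  | .unit, g, hg => (Category.id_comp (X := 𝟙_ C) g).symm.trans hg.one_hom
  | .of b, g, _ =>
    ((Category.id_comp (X := b.interp A) g).symm.trans
      ((b.isUnitary_ofUp A).2 =≫ g).symm).trans (Category.assoc _ _ _)
  | .tensor X Y, g, hg => by
    -- restated over `X.interp A ⊗ Y.interp A`, which is the source of `g` by definition
    have key (g : X.interp A ⊗ Y.interp A ⟶ Q) [IsMonHom g] :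
        g = (X.desc (fun x => (X.ι A x ≫ inl (X.interp A) (Y.interp A)) ≫ g) ⊗ₘ
          Y.desc (fun y => (Y.ι A y ≫ inr (X.interp A) (Y.interp A)) ≫ g)) ≫ μ := by
      simp only [Category.assoc]
      rw [← X.eq_desc_of (inl (X.interp A) (Y.interp A) ≫ g),
        ← Y.eq_desc_of (inr (X.interp A) (Y.interp A) ≫ g), ← OrientedSpider.eq_desc]
    exact @key g hg

/-- Homomorphisms out of `X` are determined by their restrictions to the wires. -/
lemma Ty.hom_ext {Q : C} [MonObj Q] {X : Ty} (f g : X.interp A ⟶ Q) [IsMonHom f] [IsMonHom g]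
    (h : ∀ x, X.ι A x ≫ f = X.ι A x ≫ g) : f = g := by
  rw [X.eq_desc_of f, X.eq_desc_of g]
  simp only [h]

variable (A)

/-- The action of a function between positions of wires: wires with the same image are merged. -/
def push {X Y : Ty} (k : X.Leaf → Y.Leaf) : X.interp A ⟶ Y.interp A :=
  X.desc fun x => Y.ι A (k x)

variable {X Y Z W : Ty}

instance (k : X.Leaf → Y.Leaf) : IsFrobHom (push A k) :=
  X.isFrobHom_desc _ fun _ => inferInstance

lemma ι_push (k : X.Leaf → Y.Leaf) (x : X.Leaf) : X.ι A x ≫ push A k = Y.ι A (k x) :=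
  X.ι_desc _ (fun _ => inferInstance) x

lemma eq_push (k : X.Leaf → Y.Leaf) (f : X.interp A ⟶ Y.interp A) [IsMonHom f]
    (h : ∀ x, X.ι A x ≫ f = Y.ι A (k x)) : f = push A k :=
  Ty.hom_ext _ _ fun x => by rw [h, ι_push]

lemma push_comp (k : X.Leaf → Y.Leaf) (l : Y.Leaf → Z.Leaf) :
    push A k ≫ push A l = push A (l ∘ k) :=
  eq_push _ _ _ fun x => by rw [← Category.assoc, ι_push, ι_push]; rfl

lemma push_id : push A (id : X.Leaf → X.Leaf) = 𝟙 _ :=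
  (eq_push _ _ _ fun x => by simp).symm

lemma push_inl : push A (Y := X.tensor Y) (Sum.inl : X.Leaf → X.Leaf ⊕ Y.Leaf) =
    inl (X.interp A) (Y.interp A) :=
  have : IsMonHom (N := (X.tensor Y).interp A) (inl (X.interp A) (Y.interp A)) :=
    inferInstanceAs (IsMonHom (inl (X.interp A) (Y.interp A)))
  (eq_push A (Y := X.tensor Y) _ (inl (X.interp A) (Y.interp A)) fun _ => rfl).symm

lemma push_inr : push A (Y := X.tensor Y) (Sum.inr : Y.Leaf → X.Leaf ⊕ Y.Leaf) =
    inr (X.interp A) (Y.interp A) :=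
  have : IsMonHom (N := (X.tensor Y).interp A) (inr (X.interp A) (Y.interp A)) :=
    inferInstanceAs (IsMonHom (inr (X.interp A) (Y.interp A)))
  (eq_push A (Y := X.tensor Y) _ (inr (X.interp A) (Y.interp A)) fun _ => rfl).symm

lemma push_map (k : X.Leaf → Y.Leaf) (l : Z.Leaf → W.Leaf) :
    push A (X := X.tensor Z) (Y := Y.tensor W) (Sum.map k l) = (push A k ⊗ₘ push A l) := by
  have : IsMonHom (M := (X.tensor Z).interp A) (N := (Y.tensor W).interp A)
      (push A k ⊗ₘ push A l) := inferInstanceAs (IsMonHom (push A k ⊗ₘ push A l))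
  refine (eq_push A (X := X.tensor Z) (Y := Y.tensor W) _ (push A k ⊗ₘ push A l) ?_).symm
  rintro (x | x)
  · change (X.ι A x ≫ inl (X.interp A) (Z.interp A)) ≫ (push A k ⊗ₘ push A l) =
      Y.ι A (k x) ≫ inl (Y.interp A) (W.interp A)
    rw [Category.assoc, inl_tensor, ← ι_push, Category.assoc]
  · change (Z.ι A x ≫ inr (X.interp A) (Z.interp A)) ≫ (push A k ⊗ₘ push A l) =
      W.ι A (l x) ≫ inr (Y.interp A) (W.interp A)
    rw [Category.assoc, inr_tensor, ← ι_push, Category.assoc]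

end Wires

section Structural

/-! ### Structural isomorphisms as functions between wires -/

variable {C : Type u} [Category.{v} C] [MonoidalCategory C] [SymmetricCategory C] [DaggerSMC C]

section

variable (P Q R : C) [MonObj P] [MonObj Q] [MonObj R]

lemma inl_associator : inl (P ⊗ Q) R ≫ (α_ P Q R).hom = P ◁ inl Q R := by
  simp [inl]

lemma inr_whiskerRight_associator : inr P Q ▷ R ≫ (α_ P Q R).hom = inr P (Q ⊗ R) := by
  simp [inr]

lemma inl_inl_associator : inl P Q ≫ inl (P ⊗ Q) R ≫ (α_ P Q R).hom = inl P (Q ⊗ R) := by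
  rw [inl_associator, inl, inl, Category.assoc, ← MonoidalCategory.whiskerLeft_comp,
    IsMonHom.one_hom, ← inl]

lemma inr_inl_associator :
    inr P Q ≫ inl (P ⊗ Q) R ≫ (α_ P Q R).hom = inl Q R ≫ inr P (Q ⊗ R) := by
  rw [inl_associator, ← id_tensorHom, inr_tensor]

lemma inr_associator : inr (P ⊗ Q) R ≫ (α_ P Q R).hom = inr Q R ≫ inr P (Q ⊗ R) := by
  rw [← inr_whiskerRight_associator, inr, inr, Category.assoc, Category.assoc,
    ← comp_whiskerRight_assoc, IsMonHom.one_hom]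

lemma inl_braiding : inl P Q ≫ (β_ P Q).hom = inr Q P := by
  simp [inl, inr]

lemma inr_braiding : inr P Q ≫ (β_ P Q).hom = inl Q P := by
  simp [inl, inr]

lemma inr_leftUnitor : inr (𝟙_ C) P ≫ (λ_ P).hom = 𝟙 P := by
  simp [inr]

lemma inl_rightUnitor : inl P (𝟙_ C) ≫ (ρ_ P).hom = 𝟙 P := by
  simp [inl]

end

variable [DaggerCompactWithBases C] (A : C)

lemma associator_eq_push (X Y Z : Ty) : (α_ (X.interp A) (Y.interp A) (Z.interp A)).hom =
    push A (X := (X.tensor Y).tensor Z) (Y := X.tensor (Y.tensor Z))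
      (Equiv.sumAssoc X.Leaf Y.Leaf Z.Leaf) := by
  have : IsMonHom (M := ((X.tensor Y).tensor Z).interp A) (N := (X.tensor (Y.tensor Z)).interp A)
    (α_ (X.interp A) (Y.interp A) (Z.interp A)).hom :=
    inferInstanceAs (IsMonHom (α_ (X.interp A) (Y.interp A) (Z.interp A)).hom)
  refine eq_push A (X := (X.tensor Y).tensor Z) (Y := X.tensor (Y.tensor Z)) _
    (α_ (X.interp A) (Y.interp A) (Z.interp A)).hom ?_
  rintro ((x | y) | z)
  · change ((X.ι A x ≫ inl (X.interp A) (Y.interp A)) ≫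
      inl (X.interp A ⊗ Y.interp A) (Z.interp A)) ≫ _ =
        X.ι A x ≫ inl (X.interp A) (Y.interp A ⊗ Z.interp A)
    rw [Category.assoc, Category.assoc, inl_inl_associator]
  · change ((Y.ι A y ≫ inr (X.interp A) (Y.interp A)) ≫
      inl (X.interp A ⊗ Y.interp A) (Z.interp A)) ≫ _ =
        (Y.ι A y ≫ inl (Y.interp A) (Z.interp A)) ≫ inr (X.interp A) (Y.interp A ⊗ Z.interp A)
    rw [Category.assoc, Category.assoc, Category.assoc, inr_inl_associator]
  · change (Z.ι A z ≫ inr (X.interp A ⊗ Y.interp A) (Z.interp A)) ≫ _ =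
        (Z.ι A z ≫ inr (Y.interp A) (Z.interp A)) ≫ inr (X.interp A) (Y.interp A ⊗ Z.interp A)
    rw [Category.assoc, Category.assoc, inr_associator]

lemma leftUnitor_eq_push (X : Ty) : (λ_ (X.interp A)).hom =
    push A (X := Ty.unit.tensor X) (Equiv.emptySum Empty X.Leaf) := by
  have : IsMonHom (M := (Ty.unit.tensor X).interp A) (λ_ (X.interp A)).hom :=
    inferInstanceAs (IsMonHom (λ_ (X.interp A)).hom)
  refine eq_push A (X := Ty.unit.tensor X) _ (λ_ (X.interp A)).hom ?_
  rintro (x | x)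
  · exact x.elim
  · change (X.ι A x ≫ inr (𝟙_ C) (X.interp A)) ≫ (λ_ (X.interp A)).hom = X.ι A x
    rw [Category.assoc, inr_leftUnitor, Category.comp_id]

lemma rightUnitor_eq_push (X : Ty) : (ρ_ (X.interp A)).hom =
    push A (X := X.tensor Ty.unit) (Equiv.sumEmpty X.Leaf Empty) := by
  have : IsMonHom (M := (X.tensor Ty.unit).interp A) (ρ_ (X.interp A)).hom :=
    inferInstanceAs (IsMonHom (ρ_ (X.interp A)).hom)
  refine eq_push A (X := X.tensor Ty.unit) _ (ρ_ (X.interp A)).hom ?_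
  rintro (x | x)
  · change (X.ι A x ≫ inl (X.interp A) (𝟙_ C)) ≫ (ρ_ (X.interp A)).hom = X.ι A x
    rw [Category.assoc, inl_rightUnitor, Category.comp_id]
  · exact x.elim

lemma braiding_eq_push (X Y : Ty) : (β_ (X.interp A) (Y.interp A)).hom =
    push A (X := X.tensor Y) (Y := Y.tensor X) (Equiv.sumComm X.Leaf Y.Leaf) := by
  have : IsMonHom (M := (X.tensor Y).interp A) (N := (Y.tensor X).interp A)
    (β_ (X.interp A) (Y.interp A)).hom :=
    inferInstanceAs (IsMonHom (β_ (X.interp A) (Y.interp A)).hom)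
  refine eq_push A (X := X.tensor Y) (Y := Y.tensor X) _ (β_ (X.interp A) (Y.interp A)).hom ?_
  rintro (x | x)
  · change (X.ι A x ≫ inl (X.interp A) (Y.interp A)) ≫ _ =
      X.ι A x ≫ inr (Y.interp A) (X.interp A)
    rw [Category.assoc, inl_braiding]
  · change (Y.ι A x ≫ inr (X.interp A) (Y.interp A)) ≫ _ =
      Y.ι A x ≫ inl (Y.interp A) (X.interp A)
    rw [Category.assoc, inr_braiding]

/-! ### Merging all wires -/

/-- The function sending all wires to a single one. -/
def collapse (X : Ty) : X.Leaf → (Ty.of .up).Leaf := fun _ => ()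

variable {X Y Z N M : Ty}

lemma push_comp_collapse (k : X.Leaf → Y.Leaf) :
    push A k ≫ push A (collapse Y) = push A (collapse X) := push_comp A k (collapse Y)

lemma push_collapse_tensor : push A (collapse (N.tensor M)) =
    (push A (collapse N) ⊗ₘ push A (collapse M)) ≫ μ := rfl

/-- Without wires, `N` is a tensor product of units. -/
lemma isUnitary_one_of_isEmpty : (N : Ty) → IsEmpty N.Leaf → IsUnitary η[N.interp A]
  | .unit, _ => isUnitary_id (𝟙_ C)
  | .of b, h => (h.false ()).elim
  | .tensor X Y, h => by
    have hX := isUnitary_one_of_isEmpty X ⟨fun x => h.false (Sum.inl x)⟩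
    have hY := isUnitary_one_of_isEmpty Y ⟨fun y => h.false (Sum.inr y)⟩
    exact (dagger_leftUnitor (𝟙_ C) ▸ (isUnitary_leftUnitor (𝟙_ C)).dagger).comp (hX.tensor hY)

lemma dagger_comp_collapse_of_isEmpty (N : Ty) (h : IsEmpty N.Leaf) :
    (push A (collapse N))† ≫ push A (collapse N) = η[(Ty.of .up).interp A]† ≫ η := by
  have hu := isUnitary_one_of_isEmpty A N h
  have ht : push A (collapse N) = η[N.interp A]† ≫ η := by
    rw [← IsMonHom.one_hom (f := push A (collapse N)), ← Category.assoc, hu.2, Category.id_comp]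
  rw [ht, dagger_comp, dagger_dagger, Category.assoc, reassoc_of% hu.1]

/-- Splitting one wire into at least one and merging again is the identity. Without any wire in
between, the composite would be `η ∘ η†`. -/
lemma dagger_comp_collapse : (N : Ty) → Nonempty N.Leaf →
    (push A (collapse N))† ≫ push A (collapse N) = 𝟙 ((Ty.of .up).interp A)
  | .unit, h => (h.some : Empty).elim
  | .of b, _ => by
    have h : push A (collapse (.of b)) = (b.ofUp A)† := Category.comp_id _
    rw [h]
    exact (b.isUnitary_ofUp A).dagger.2
  | .tensor X Y, h => by
    rw [push_collapse_tensor]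
    change ((push A (collapse X) ⊗ₘ push A (collapse Y)) ≫ μ)† ≫
      (push A (collapse X) ⊗ₘ push A (collapse Y)) ≫ μ = 𝟙 _
    rw [dagger_comp, dagger_tensor, Category.assoc, tensorHom_comp_tensorHom_assoc]
    rcases isEmpty_or_nonempty X.Leaf with hX | hX
    · have hY : Nonempty Y.Leaf := by
        rcases h with ⟨x | y⟩
        exacts [(hX.false x).elim, ⟨y⟩]
      rw [dagger_comp_collapse Y hY, dagger_comp_collapse_of_isEmpty A X hX, tensorHom_id,
        comp_whiskerRight, Category.assoc, MonObj.one_mul, ← Category.assoc]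
      apply dagger_injective
      simp
    · rw [dagger_comp_collapse X hX]
      rcases isEmpty_or_nonempty Y.Leaf with hY | hY
      · rw [dagger_comp_collapse_of_isEmpty A Y hY, id_tensorHom,
          MonoidalCategory.whiskerLeft_comp, Category.assoc, MonObj.mul_one, ← Category.assoc]
        apply dagger_injective
        simp
      · rw [dagger_comp_collapse Y hY, id_tensorHom_id, Category.id_comp,
          IsDaggerFrobenius.special]

/-! ### Operators identifying wires -/

variable {A}

/-- A module endomorphism applied to a product of legs can be applied to any one leg instead, so
legs which it does not distinguish are interchangeable. -/
lemma IsModuleEnd.desc_comp_congr {Q : C} [MonObj Q] [IsDaggerFrobenius Q] {Φ : Q ⟶ Q}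
    (hΦ : IsModuleEnd Φ) : (X : Ty) → (f g : X.Leaf → (Dir.up.interp A ⟶ Q)) →
      (∀ x, f x ≫ Φ = g x ≫ Φ) → X.desc f ≫ Φ = X.desc g ≫ Φ
  | .unit, _, _, _ => rfl
  | .of b, f, g, h => by
    exact (Category.assoc _ _ _).trans (((b.ofUp A)† ≫= h ()).trans (Category.assoc _ _ _).symm)
  | .tensor X Y, f, g, h => by
    have hX := hΦ.desc_comp_congr X (f ∘ Sum.inl) (g ∘ Sum.inl) fun x => h _
    have hY := hΦ.desc_comp_congr Y (f ∘ Sum.inr) (g ∘ Sum.inr) fun y => h _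
    have h1 {P R : C} (a a' : P ⟶ Q) (b : R ⟶ Q) (h : a ≫ Φ = a' ≫ Φ) :
        ((a ⊗ₘ b) ≫ μ) ≫ Φ = ((a' ⊗ₘ b) ≫ μ) ≫ Φ := by
      simp only [Category.assoc, hΦ.mul_comp, ← tensorHom_id, tensorHom_comp_tensorHom_assoc, h]
    have h2 {P R : C} (a : P ⟶ Q) (b b' : R ⟶ Q) (h : b ≫ Φ = b' ≫ Φ) :
        ((a ⊗ₘ b) ≫ μ) ≫ Φ = ((a ⊗ₘ b') ≫ μ) ≫ Φ := by
      simp only [Category.assoc, hΦ.mul_comp', ← id_tensorHom, tensorHom_comp_tensorHom_assoc, h]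
    exact (h1 _ _ _ hX).trans (h2 _ _ _ hY)

/-- `Φ` is an operator on the wires of `N` which does not distinguish wires related by `r`, and
which has no effect if all wires are merged afterwards. The latter condition normalizes `Φ`: it rules out
scalar factors. -/
structure Identifies (r : N.Leaf → N.Leaf → Prop) (Φ : N.interp A ⟶ N.interp A) : Prop where
  isModuleEnd : IsModuleEnd Φ
  ι_comp : ∀ a b, r a b → N.ι A a ≫ Φ = N.ι A b ≫ Φ
  comp_collapse : Φ ≫ push A (collapse N) = push A (collapse N)

namespace Identifies

variable {r s : N.Leaf → N.Leaf → Prop} {Φ Ψ : N.interp A ⟶ N.interp A}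

lemma mono (h : Identifies r Φ) (hs : ∀ a b, s a b → r a b ∨ r b a) : Identifies s Φ where
  isModuleEnd := h.isModuleEnd
  ι_comp a b hab := (hs a b hab).elim (h.ι_comp a b) fun h' => (h.ι_comp b a h').symm
  comp_collapse := h.comp_collapse

lemma id (hr : ∀ a b, ¬ r a b) : Identifies r (𝟙 (N.interp A)) where
  isModuleEnd := .id
  ι_comp a b h := (hr a b h).elim
  comp_collapse := Category.id_comp _

lemma comp (hΦ : Identifies r Φ) (hΨ : Identifies s Ψ) :
    Identifies (fun a b => r a b ∨ s a b) (Φ ≫ Ψ) where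
  isModuleEnd := hΦ.isModuleEnd.comp hΨ.isModuleEnd
  ι_comp a b h := by
    rcases h with h | h
    · rw [reassoc_of% hΦ.ι_comp a b h]
    · rw [hΦ.isModuleEnd.comm hΨ.isModuleEnd, reassoc_of% hΨ.ι_comp a b h]
  comp_collapse := by rw [Category.assoc, hΨ.comp_collapse, hΦ.comp_collapse]

lemma tensor {t : M.Leaf → M.Leaf → Prop} {Χ : M.interp A ⟶ M.interp A} (hΦ : Identifies r Φ)
    (hΧ : Identifies t Χ) :
    Identifies (N := N.tensor M) (Sum.LiftRel r t) (Φ ⊗ₘ Χ) where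
  isModuleEnd := hΦ.isModuleEnd.tensor hΧ.isModuleEnd
  ι_comp := by
    have hl {a : N.Leaf} : (N.ι A a ≫ inl (N.interp A) (M.interp A)) ≫ (Φ ⊗ₘ Χ) =
        (N.ι A a ≫ Φ) ≫ inl (N.interp A) (M.interp A) ≫ (𝟙 _ ⊗ₘ Χ) := by
      have h := inl_tensor (Q := M.interp A) Φ (𝟙 _) =≫ (𝟙 (N.interp A) ⊗ₘ Χ)
      rw [Category.assoc, Category.assoc, tensorHom_comp_tensorHom, Category.comp_id,
        Category.id_comp] at h
      rw [Category.assoc, Category.assoc, h]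
    have hr {a : M.Leaf} : (M.ι A a ≫ inr (N.interp A) (M.interp A)) ≫ (Φ ⊗ₘ Χ) =
        (M.ι A a ≫ Χ) ≫ inr (N.interp A) (M.interp A) ≫ (Φ ⊗ₘ 𝟙 _) := by
      have h := inr_tensor (P := N.interp A) (𝟙 _) Χ =≫ (Φ ⊗ₘ 𝟙 (M.interp A))
      rw [Category.assoc, Category.assoc, tensorHom_comp_tensorHom, Category.comp_id,
        Category.id_comp] at h
      rw [Category.assoc, Category.assoc, h]
    rintro _ _ (⟨h⟩ | ⟨h⟩)
    · exact hl.trans ((congrArg (· ≫ _) (hΦ.ι_comp _ _ h)).trans hl.symm)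
    · exact hr.trans ((congrArg (· ≫ _) (hΧ.ι_comp _ _ h)).trans hr.symm)
  comp_collapse := by
    change (Φ ⊗ₘ Χ) ≫ (push A (collapse N) ⊗ₘ push A (collapse M)) ≫ μ =
      (push A (collapse N) ⊗ₘ push A (collapse M)) ≫ μ
    rw [tensorHom_comp_tensorHom_assoc, hΦ.comp_collapse, hΧ.comp_collapse]

lemma dagger_comp {Φ Ψ : N.interp A ⟶ N.interp A} (hΦ : Identifies r Φ†)
    (hΨ : Identifies s Ψ†) : Identifies (fun a b => r a b ∨ s a b) (Φ ≫ Ψ)† := by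
  rw [DaggerSMC.dagger_comp]
  exact (hΨ.comp hΦ).mono fun a b h => .inl h.symm

lemma dagger_tensor {t : M.Leaf → M.Leaf → Prop} {Χ : M.interp A ⟶ M.interp A}
    (hΦ : Identifies r Φ†) (hΧ : Identifies t Χ†) :
    Identifies (N := N.tensor M) (Sum.LiftRel r t) (Φ ⊗ₘ Χ)† :=
  (DaggerSMC.dagger_tensor Φ Χ).symm ▸ hΦ.tensor hΧ

lemma link (k l : Y.Leaf → N.Leaf) :
    Identifies (fun a b => ∃ y, a = k y ∧ b = l y) (link (push A k) (push A l)) where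
  isModuleEnd := .act _
  ι_comp := by
    rintro _ _ ⟨y, rfl, rfl⟩
    rw [← ι_push, ← ι_push, Category.assoc, Category.assoc, comp_link_left, comp_link_right]
  comp_collapse := link_comp _ _ _ (by rw [push_comp_collapse, push_comp_collapse])

lemma dagger_link (k l : Y.Leaf → N.Leaf) :
    Identifies (fun a b => ∃ y, a = k y ∧ b = l y)
      (OrientedSpider.link (push A k) (push A l))† where
  isModuleEnd := (IsModuleEnd.act _).dagger
  ι_comp := by
    rintro _ _ ⟨y, rfl, rfl⟩
    have h : push A k ≫ (OrientedSpider.link (push A k) (push A l))† =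
        push A l ≫ (OrientedSpider.link (push A k) (push A l))† := by
      apply dagger_injective
      simp only [DaggerSMC.dagger_comp, dagger_dagger, link_comp_dagger_left,
        link_comp_dagger_right]
    rw [← ι_push, ← ι_push, Category.assoc, Category.assoc, h]
  comp_collapse := by
    apply dagger_injective
    rw [DaggerSMC.dagger_comp, dagger_dagger]
    exact dagger_comp_link _ _ _ (by rw [push_comp_collapse, push_comp_collapse])

lemma push_comp_congr (h : Identifies r Φ) (hr : ∀ a b, r a b) (k l : X.Leaf → N.Leaf) :
    push A k ≫ Φ = push A l ≫ Φ :=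
  h.isModuleEnd.desc_comp_congr X _ _ fun _ => h.ι_comp _ _ (hr _ _)

/-- An operator identifying all wires merges the inputs into a single wire, from which all outputs
are split off. -/
lemma push_comp_comp_dagger_push (h : Identifies r Φ) (h' : Identifies r Φ†)
    (hr : ∀ a b, r a b) (n : N.Leaf) (p : X.Leaf → N.Leaf) (q : Y.Leaf → N.Leaf) :
    push A p ≫ Φ ≫ (push A q)† = push A (collapse X) ≫ (push A (collapse Y))† := by
  -- all wires of `N` are treated like the wire `n`, so `Φ` factors through `s` and `s†`
  let s : (Ty.of .up).interp A ⟶ N.interp A := push A fun _ => n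
  let t : N.interp A ⟶ (Ty.of .up).interp A := push A (collapse N)
  have hpush {Z : Ty} (k : Z.Leaf → N.Leaf) : push A k ≫ Φ = push A (collapse Z) ≫ s ≫ Φ := by
    rw [← Category.assoc, push_comp]
    exact h.push_comp_congr hr _ _
  have hpull {Z : Ty} (k : Z.Leaf → N.Leaf) :
      Φ ≫ (push A k)† = Φ ≫ s† ≫ (push A (collapse Z))† := by
    apply dagger_injective
    simp only [DaggerSMC.dagger_comp, dagger_dagger, Category.assoc]
    rw [← Category.assoc _ s, push_comp]
    exact h'.push_comp_congr hr _ _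
  -- merging after `Φ ≫ s† ≫ t†`, which equals `Φ`, has no effect but cancels `t†`
  have ht : Φ ≫ s† = t := by
    have h1 := hpull (_root_.id : N.Leaf → N.Leaf)
    rw [push_id, dagger_id, Category.comp_id] at h1
    symm
    calc t = Φ ≫ t := h.comp_collapse.symm
      _ = (Φ ≫ s† ≫ t†) ≫ t := congrArg (· ≫ t) h1
      _ = Φ ≫ s† := by
        rw [Category.assoc, Category.assoc, dagger_comp_collapse A N ⟨n⟩, Category.comp_id]
  have hst : s ≫ t = 𝟙 _ := (push_comp A _ _).trans (push_id A)
  rw [hpull, ← Category.assoc, hpush, Category.assoc, Category.assoc, reassoc_of% ht,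
    reassoc_of% hst]

end Identifies

end Structural

section Realization

/-! ### Factorization of diagrams along their graphs -/

variable {C : Type u} [Category.{v} C] [MonoidalCategory C] [SymmetricCategory C] [DaggerSMC C]
  [DaggerCompactWithBases C] {A : C} {X Y Z X' Y' : Ty}

/-- A factorization of `f` along the graph `G`: send the inputs to their nodes, identify the nodes
joined by edges, split off the outputs. The nodes are represented by the wires of a tensor
expression, through a surjection. Both `op` and its dagger are required to identify adjacent nodes,
to control the two sides of `op`. -/
structure Realization (G : OpenGraph X Y) (f : X.interp A ⟶ Y.interp A) where
  nodes : Ty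
  toNodes : G.Node → nodes.Leaf
  surjective : Function.Surjective toNodes
  op : nodes.interp A ⟶ nodes.interp A
  identifies : Identifies (Relation.Map G.graph.Adj toNodes toNodes) op
  identifies_dagger : Identifies (Relation.Map G.graph.Adj toNodes toNodes) op†
  fac : f = push A (toNodes ∘ G.inp) ≫ op ≫ (push A (toNodes ∘ G.out))†

namespace Realization

section

variable {G : OpenGraph X Y} {H : OpenGraph X' Y'} {S T : Type*} {i : G.Node → S} {j : H.Node → T}
  {a b : S ⊕ T}

lemma map_sum_adj
    (h : Relation.Map (G.tensor H).graph.Adj (Sum.map i j) (Sum.map i j) a b) :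
    Sum.LiftRel (Relation.Map G.graph.Adj i i) (Relation.Map H.graph.Adj j j) a b ∨
      Sum.LiftRel (Relation.Map G.graph.Adj i i) (Relation.Map H.graph.Adj j j) b a := by
  obtain ⟨x | x, y | y, h, rfl, rfl⟩ := h
  · exact .inl (.inl ⟨x, y, h, rfl, rfl⟩)
  · exact (Bool.false_ne_true h).elim
  · exact (Bool.false_ne_true h).elim
  · exact .inl (.inr ⟨x, y, h, rfl, rfl⟩)

lemma map_comp_adj {H : OpenGraph Y Z} {j : H.Node → T}
    (h : Relation.Map (G.comp H).graph.Adj (Sum.map i j) (Sum.map i j) a b) :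
    (Sum.LiftRel (Relation.Map G.graph.Adj i i) (Relation.Map H.graph.Adj j j) a b ∨
      ∃ y, a = Sum.inl (i (G.out y)) ∧ b = Sum.inr (j (H.inp y))) ∨
    (Sum.LiftRel (Relation.Map G.graph.Adj i i) (Relation.Map H.graph.Adj j j) b a ∨
      ∃ y, b = Sum.inl (i (G.out y)) ∧ a = Sum.inr (j (H.inp y))) := by
  obtain ⟨x, y, h | h, rfl, rfl⟩ := h
  · rcases x with x | x <;> rcases y with y | y
    · exact .inl (.inl (.inl ⟨x, y, h, rfl, rfl⟩))
    · exact (Bool.false_ne_true h).elim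
    · exact (Bool.false_ne_true h).elim
    · exact .inl (.inl (.inr ⟨x, y, h, rfl, rfl⟩))
  · obtain ⟨-, ⟨y, rfl, rfl⟩ | ⟨y, rfl, rfl⟩⟩ := h
    · exact .inl (.inr ⟨y, rfl, rfl⟩)
    · exact .inr (.inr ⟨y, rfl, rfl⟩)

end

/-- The realization of a collection of wires. -/
def wires (e : X.Leaf ≃ Y.Leaf) (f : X.interp A ⟶ Y.interp A) (hf : f = push A e) :
    Realization (OpenGraph.wires e) f where
  nodes := Y
  toNodes := e
  surjective := e.surjective
  op := 𝟙 _
  identifies := .id fun _ _ ⟨_, _, h, _⟩ => h.elim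
  identifies_dagger := by
    rw [dagger_id]
    exact .id fun _ _ ⟨_, _, h, _⟩ => h.elim
  fac := by
    change f = push A e ≫ 𝟙 _ ≫ (push A (e ∘ e.symm))†
    rw [e.self_comp_symm, push_id, dagger_id, Category.comp_id, Category.comp_id, hf]

/-- The realization of a dot with a single input, which is split into the outputs. -/
def dot (b : Dir) (f : (Ty.of b).interp A ⟶ Y.interp A)
    (hf : f† = push A (Y := .of b) fun _ => ()) : Realization (OpenGraph.dot (.of b) Y) f where
  nodes := .of b
  toNodes := fun _ => ()
  surjective := fun _ => ⟨(), rfl⟩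
  op := 𝟙 _
  identifies := .id fun _ _ ⟨_, _, h, _⟩ => h.elim
  identifies_dagger := by
    rw [dagger_id]
    exact .id fun _ _ ⟨_, _, h, _⟩ => h.elim
  fac := by
    have h : f = (push A (Y := .of b) fun _ : Y.Leaf => ())† := by rw [← hf, dagger_dagger]
    refine h.trans ?_
    have h1 := push_id A (X := .of b)
    refine Eq.trans ?_ (congrArg (· ≫ _) h1).symm
    rw [Category.id_comp, Category.id_comp]
    rfl

/-- The realization of a vertical reflection. -/
def dag {G : OpenGraph X Y} {f : X.interp A ⟶ Y.interp A} (R : Realization G f) :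
    Realization G.dag f† where
  nodes := R.nodes
  toNodes := R.toNodes
  surjective := R.surjective
  op := R.op†
  identifies := R.identifies_dagger
  identifies_dagger := by
    rw [dagger_dagger]
    exact R.identifies
  fac := by
    conv_lhs => rw [R.fac]
    simp only [dagger_comp, dagger_dagger, Category.assoc]
    rfl

/-- The realization of a parallel composition. -/
def tensor {G : OpenGraph X Y} {H : OpenGraph X' Y'} {f : X.interp A ⟶ Y.interp A}
    {g : X'.interp A ⟶ Y'.interp A} (R : Realization G f) (S : Realization H g) :
    Realization (X := X.tensor X') (Y := Y.tensor Y') (G.tensor H) (f ⊗ₘ g) where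
  nodes := R.nodes.tensor S.nodes
  toNodes := Sum.map R.toNodes S.toNodes
  surjective := R.surjective.sumMap S.surjective
  op := R.op ⊗ₘ S.op
  identifies := (R.identifies.tensor S.identifies).mono fun _ _ => map_sum_adj
  identifies_dagger :=
    (R.identifies_dagger.dagger_tensor S.identifies_dagger).mono fun _ _ => map_sum_adj
  fac := by
    have h1 := push_map A (R.toNodes ∘ G.inp) (S.toNodes ∘ H.inp)
    have h2 := push_map A (R.toNodes ∘ G.out) (S.toNodes ∘ H.out)
    rw [← Sum.map_comp_map] at h1 h2
    have h : (f ⊗ₘ g) = (push A (R.toNodes ∘ G.inp) ⊗ₘ push A (S.toNodes ∘ H.inp)) ≫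
        (R.op ⊗ₘ S.op) ≫ (push A (R.toNodes ∘ G.out) ⊗ₘ push A (S.toNodes ∘ H.out))† := by
      rw [dagger_tensor, tensorHom_comp_tensorHom, tensorHom_comp_tensorHom, ← R.fac, ← S.fac]
    refine h.trans ?_
    rw [← h1, ← h2]
    rfl

/-- The realization of a sequential composition: the outputs of `G` are linked to the
inputs of `H`. -/
def comp {G : OpenGraph X Y} {H : OpenGraph Y Z} {f : X.interp A ⟶ Y.interp A}
    {g : Y.interp A ⟶ Z.interp A} (R : Realization G f) (S : Realization H g) :
    Realization (G.comp H) (f ≫ g) where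
  nodes := R.nodes.tensor S.nodes
  toNodes := Sum.map R.toNodes S.toNodes
  surjective := R.surjective.sumMap S.surjective
  op := (R.op ⊗ₘ S.op) ≫ link
    (push A (Y := R.nodes.tensor S.nodes) fun y => Sum.inl (R.toNodes (G.out y)))
    (push A (Y := R.nodes.tensor S.nodes) fun y => Sum.inr (S.toNodes (H.inp y)))
  identifies := ((R.identifies.tensor S.identifies).comp (.link _ _)).mono fun _ _ => map_comp_adj
  identifies_dagger :=
    ((R.identifies_dagger.dagger_tensor S.identifies_dagger).dagger_comp
      (.dagger_link _ _)).mono fun _ _ => map_comp_adj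
  fac := by
    have h1 := push_comp A (Y := R.nodes) (Z := R.nodes.tensor S.nodes) (R.toNodes ∘ G.inp) Sum.inl
    have h2 := push_comp A (Y := R.nodes) (Z := R.nodes.tensor S.nodes) (R.toNodes ∘ G.out) Sum.inl
    have h3 := push_comp A (Y := S.nodes) (Z := R.nodes.tensor S.nodes) (S.toNodes ∘ H.inp) Sum.inr
    have h4 := push_comp A (Y := S.nodes) (Z := R.nodes.tensor S.nodes) (S.toNodes ∘ H.out) Sum.inr
    rw [push_inl] at h1 h2
    rw [push_inr] at h3 h4
    exact comp_eq_of_fac S.identifies.isModuleEnd R.fac S.fac h1 h2 h3 h4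

/-- A morphism realized by a connected graph merges all inputs into one wire and splits it into the
outputs. -/
lemma eq_of_connected {G : OpenGraph X Y} {f : X.interp A ⟶ Y.interp A} (R : Realization G f)
    (hG : G.graph.Connected) : f = push A (collapse X) ≫ (push A (collapse Y))† := by
  have key {Φ : R.nodes.interp A ⟶ R.nodes.interp A}
      (h : Identifies (Relation.Map G.graph.Adj R.toNodes R.toNodes) Φ) :
      Identifies (fun _ _ => True) Φ := by
    have h' (i j : G.Node) : R.nodes.ι A (R.toNodes i) ≫ Φ = R.nodes.ι A (R.toNodes j) ≫ Φ := by
      induction (SimpleGraph.reachable_iff_reflTransGen i j).1 (hG.preconnected i j) with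
      | refl => rfl
      | tail _ hadj ih => exact ih.trans (h.ι_comp _ _ ⟨_, _, hadj, rfl, rfl⟩)
    refine ⟨h.isModuleEnd, fun a b _ => ?_, h.comp_collapse⟩
    obtain ⟨i, rfl⟩ := R.surjective a
    obtain ⟨j, rfl⟩ := R.surjective b
    exact h' i j
  obtain ⟨n⟩ := hG.nonempty
  exact R.fac.trans ((key R.identifies).push_comp_comp_dagger_push (key R.identifies_dagger)
    (fun _ _ => trivial) (R.toNodes n) _ _)

end Realization

end Realization

section Interpretation

/-! ### Connected diagrams are spiders -/

variable {C : Type u} [Category.{v} C] [MonoidalCategory C] [SymmetricCategory C] [DaggerSMC C]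
  [DaggerCompactWithBases C] (A : C) {X Y X' Y' : Ty}

lemma dualiser_down : Dir.down.dualiser A = (Dir.up.dualiser A)† :=
  DaggerCompactWithBases.dualiser_dual A

lemma dualiser_eq (b : Dir) : b.dualiser A = (b.ofUp A)† ≫ b.flip.ofUp A := by
  cases b with
  | up =>
    change Dir.up.dualiser A = (𝟙 _)† ≫ Dir.up.dualiser A
    rw [dagger_id, Category.id_comp]
  | down => exact (dualiser_down A).trans (Category.comp_id _).symm

/-- Every diagram factors along its underlying graph. -/
def Diagram.realization : {X Y : Ty} → (Ξ : Diagram X Y) → Realization Ξ.toGraph (Ξ.interp A)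
  | _, _, .id X => .wires (Equiv.refl X.Leaf) _ (push_id A).symm
  | _, _, .comp f g => f.realization.comp g.realization
  | _, _, .tensor f g => f.realization.tensor g.realization
  | _, _, .dag f => f.realization.dag
  | _, _, .assoc X Y Z => .wires (X := (X.tensor Y).tensor Z) (Y := X.tensor (Y.tensor Z))
      (Equiv.sumAssoc X.Leaf Y.Leaf Z.Leaf) _ (associator_eq_push A X Y Z)
  | _, _, .leftUnit X => .wires (X := Ty.unit.tensor X) (Equiv.emptySum Empty X.Leaf) _
      (leftUnitor_eq_push A X)
  | _, _, .rightUnit X => .wires (X := X.tensor Ty.unit) (Equiv.sumEmpty X.Leaf Empty) _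
      (rightUnitor_eq_push A X)
  | _, _, .swap X Y => .wires (X := X.tensor Y) (Y := Y.tensor X)
      (Equiv.sumComm X.Leaf Y.Leaf) _ (braiding_eq_push A X Y)
  | _, _, .delta b => .dot b _ <| by
    have h : push A (X := (Ty.of b).tensor (.of b)) (Y := .of b) (fun _ => ()) =
        (push A _root_.id ⊗ₘ push A _root_.id) ≫ μ[(Ty.of b).interp A] := rfl
    rw [h, push_id, id_tensorHom_id]
    exact (Category.id_comp _).symm
  | _, _, .gamma b => .dot b _ rfl
  | _, _, .dualiser b => by
    have h : (b.dualiser A)† = push A (X := .of b.flip) (Y := .of b) fun _ => () := by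
      rw [dualiser_eq, dagger_comp, dagger_dagger]
      rfl
    exact .dot b _ h

lemma interp_leg : (b : Dir) → (leg b).interp A = (b.ofUp A)†
  | .up => (dagger_id _).symm
  | .down => dualiser_down A

lemma interp_merge : (w : List Dir) → (merge w).interp A = push A (collapse (Ty.ofList w))
  | [] => rfl
  | b :: w => by
    have h : push A (collapse (.of b)) = (leg b).interp A :=
      (Category.comp_id _).trans (interp_leg A b).symm
    refine Eq.trans ?_ (push_collapse_tensor A (N := .of b) (M := Ty.ofList w)).symm
    rw [h, ← interp_merge w]
    rfl

lemma interp_spider (w w' : List Dir) : (spider w w').interp A =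
    push A (collapse (Ty.ofList w)) ≫ (push A (collapse (Ty.ofList w')))† := by
  rw [← interp_merge, ← interp_merge]
  rfl

/-- `f` is the action of a function between positions of wires. -/
def IsPush (f : X.interp A ⟶ Y.interp A) : Prop := ∃ k : X.Leaf → Y.Leaf, f = push A k

variable {A}

lemma IsPush.comp {f : X.interp A ⟶ Y.interp A} {g : Y.interp A ⟶ X'.interp A} (hf : IsPush A f)
    (hg : IsPush A g) : IsPush A (f ≫ g) := by
  obtain ⟨k, rfl⟩ := hf
  obtain ⟨l, rfl⟩ := hg
  exact ⟨_, push_comp A k l⟩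

lemma IsPush.tensor {f : X.interp A ⟶ Y.interp A} {g : X'.interp A ⟶ Y'.interp A}
    (hf : IsPush A f) (hg : IsPush A g) :
    IsPush A (X := X.tensor X') (Y := Y.tensor Y') (f ⊗ₘ g) := by
  obtain ⟨k, rfl⟩ := hf
  obtain ⟨l, rfl⟩ := hg
  exact ⟨_, (push_map A k l).symm⟩

lemma isPush_id (X : Ty) : IsPush A (𝟙 (X.interp A)) := ⟨id, (push_id A).symm⟩

lemma isPush_append : (w w' : List Dir) →
    IsPush A (X := (Ty.ofList w).tensor (Ty.ofList w')) ((append w w').interp A)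
  | [], w' => ⟨_, leftUnitor_eq_push A (Ty.ofList w')⟩
  | b :: w, w' =>
    .comp ⟨_, associator_eq_push A (.of b) (Ty.ofList w) (Ty.ofList w')⟩
      ((isPush_id (.of b)).tensor (isPush_append w w'))

lemma isPush_flatten : (X : Ty) → IsPush A ((flatten X).interp A)
  | .unit => isPush_id .unit
  | .of b => by
    refine ⟨Sum.inl, ?_⟩
    have h : (ρ_ ((Ty.of b).interp A)).hom† = inl ((Ty.of b).interp A) (Ty.unit.interp A) := by
      rw [dagger_rightUnitor]
      exact ((_ ≫= MonoidalCategory.whiskerLeft_id _ _).trans (Category.comp_id _)).symm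
    exact h.trans (push_inl A (X := .of b) (Y := .unit)).symm
  | .tensor X Y => ((isPush_flatten X).tensor (isPush_flatten Y)).comp (isPush_append _ _)

lemma isUnitary_append : (w w' : List Dir) → IsUnitary ((append w w').interp A)
  | [], _ => isUnitary_leftUnitor _
  | _ :: w, w' =>
    (isUnitary_associator _ _ _).comp ((isUnitary_id _).tensor (isUnitary_append w w'))

lemma isUnitary_flatten : (X : Ty) → IsUnitary ((flatten X).interp A)
  | .unit => isUnitary_id _
  | .of _ => (isUnitary_rightUnitor _).dagger
  | .tensor X Y =>
    ((isUnitary_flatten X).tensor (isUnitary_flatten Y)).comp (isUnitary_append _ _)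

lemma flatten_comp_collapse (X : Ty) :
    (flatten X).interp A ≫ push A (collapse (Ty.ofList X.word)) = push A (collapse X) := by
  obtain ⟨k, hk⟩ := isPush_flatten (A := A) X
  rw [hk, push_comp_collapse]

/-- A connected diagram is a spider. -/
lemma Diagram.Connected.interp_eq {Ξ : Diagram X Y} (h : Ξ.Connected) :
    Ξ.interp A = (flatten X).interp A ≫ (spider X.word Y.word).interp A ≫
      (flatten Y).dag.interp A := by
  rw [interp_spider, (Ξ.realization A).eq_of_connected h, ← flatten_comp_collapse X,
    ← flatten_comp_collapse Y, dagger_comp]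
  simp only [Category.assoc]
  rfl

/-- The rebracketing of `X`, with target indexed by a list equal to `X.word`, as in `rebracket`. -/
lemma isUnitary_cast_flatten {w : List Dir} (h : X.word = w) :
    IsUnitary (Diagram.interp A (h ▸ flatten X : Diagram X (Ty.ofList w))) := by
  subst h
  exact isUnitary_flatten X

lemma Diagram.Connected.interp_eq_cast {Ξ : Diagram X Y} (h : Ξ.Connected) {w w' : List Dir}
    (hX : X.word = w) (hY : Y.word = w') :
    Ξ.interp A = Diagram.interp A (hX ▸ flatten X : Diagram X (Ty.ofList w)) ≫
      (spider w w').interp A ≫ (Diagram.interp A (hY ▸ flatten Y : Diagram Y (Ty.ofList w')))† := by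
  subst hX hY
  exact h.interp_eq

end Interpretation

end OrientedSpider

theorem mainTheorem2 {C : Type u} [Category.{v} C] [MonoidalCategory C] [SymmetricCategory C]
    [OrientedSpider.DaggerSMC C] [OrientedSpider.DaggerCompactWithBases C] (A : C) :
    (∀ {X Y : OrientedSpider.Ty} (Ξ : OrientedSpider.Diagram X Y), Ξ.Connected →
      Ξ.interp A =
        (OrientedSpider.flatten X).interp A ≫
          (OrientedSpider.spider X.word Y.word).interp A ≫
            (OrientedSpider.flatten Y).dag.interp A) ∧
    (∀ {X X' Y Y' : OrientedSpider.Ty} (Ξ : OrientedSpider.Diagram X Y)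
        (Ξ' : OrientedSpider.Diagram X' Y') (hX : X.word = X'.word) (hY : Y.word = Y'.word),
      Ξ.Connected → Ξ'.Connected →
        Ξ.interp A ≫ (OrientedSpider.rebracket hY).interp A =
          (OrientedSpider.rebracket hX).interp A ≫ Ξ'.interp A) := by
  refine ⟨fun Ξ h => h.interp_eq, fun {X X' Y Y'} Ξ Ξ' hX hY h h' => ?_⟩
  have hr {Z Z' : OrientedSpider.Ty} (hZ : Z.word = Z'.word) :
      (OrientedSpider.rebracket hZ).interp A = OrientedSpider.Diagram.interp A
        (hZ ▸ OrientedSpider.flatten Z :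
          OrientedSpider.Diagram Z (OrientedSpider.Ty.ofList Z'.word)) ≫
        OrientedSpider.DaggerSMC.dagger ((OrientedSpider.flatten Z').interp A) := rfl
  rw [hr, hr, h.interp_eq_cast hX hY, h'.interp_eq_cast rfl rfl]
  simp only [Category.assoc]
  rw [reassoc_of% (OrientedSpider.isUnitary_cast_flatten (A := A) hY).2,
    reassoc_of% (OrientedSpider.isUnitary_flatten (A := A) X').2]
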